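/- **Setting.** Let $M$ be a finite-dimensional $C^\infty$ manifold, $H\subseteq TM$ a $C^\infty$ vector subbundle, and $P^H_p:T_pM\to T_pM/H_p$ the canonical projection. The *curvature tensor* of $H$ at $p$ is the linear map $C^H_p\in\mathrm{Hom}(H_p\wedge H_p,\,T_pM/H_p)$ given by $C^H_p(X_p\wedge Y_p)=P^H_p\,[X,Y]_p$ for smooth (local) sections $X,Y$ of $H$. For a $C^\infty$ vector subbundle $K\subseteq TM$ that is supplementary to $H$ (i.e. $H_p\oplus K_p=T_pM$ for all $p\in M$), let $P^{K_p}_{H_p}:T_pM\to H_p$ be the projection onto $H_p$ along $K_p$, and let $Q^{H_p}_{K_p}:T_pM/H_p\to K_p$ be the canonical isomorphism. Let $I\subseteq\mathbf R$ be an interval with more than one point and $\beta_0:I\to M$ a $C^\infty$ path tangent to $H$: $\dot\beta_0(t)\in H_{\beta_0(t)}$ for all $t\in I$. The bundle $\beta_0^*K\to I$ carries the linear connection whose horizontal subspace at $(t,k)$, $k\in K_{\beta_0(t)}$, is $(T_{(t,k)}q)^{-1}\bigl(T_kK\cap\omega_M(TH)\bigr)$, where $q:\beta_0^*K\to K\subseteq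 TM$ is the canonical map, $\omega_M$ is the canonical involution of $T(TM)$ (in local coordinates $(x,y;u,v)\mapsto(x,u;y,v)$), and $H$, $K$ also denote the total spaces, as submanifolds of $TM$. Let $(\beta_0^*K)_s^t:K_{\beta_0(s)}\to K_{\beta_0(t)}$ $(s,t\in I)$ be its parallel transport, and $$[\beta_0^*K]_s^t:=\bigl(Q^{H_{\beta_0(t)}}_{K_{\beta_0(t)}}\bigr)^{-1}(\beta_0^*K)_s^t\;Q^{H_{\beta_0(s)}}_{K_{\beta_0(s)}}:\;T_{\beta_0(s)}M/H_{\beta_0(s)}\to T_{\beta_0(t)}M/H_{\beta_0(t)}.$$ **Theorem 10.** Let $K^1,K^2$ be two $C^\infty$ vector subbundles of $TM$, each supplementary to $H$, and let $\beta_0:I\to M$ be a $C^\infty$ path tangent to $H$. Then for every $t_0\in I$, every $v\in T_{\beta_0(t_0)}M/H_{\beta_0(t_0)}$ and every $t\in I$ the derivative below exists (one-sided at an end point of $I$) and $$\frac{\mathrm d}{\mathrm dt}\Bigl\{[\beta_0^*K^1]_t^{t_0}\,[\beta_0^*K^2]_{t_0}^{t}\,v\Bigr\}=[\beta_0^*K^1]_t^{t_0}\;C^H_{\beta_0(t)}\Bigl(P^{K^1_{\beta_0(t)}}_{H_{\beta_0(t)}}\,Q^{H_{\beta_0(t)}}_{K^2_{\beta_0(t)}}\,[\beta_0^*K^2]_{t_0}^{t}\,v\,\wedge\,\dot\beta_0(t)\Bigr).$$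 -/

import Mathlib

open Set Filter Topology
open scoped Manifold ContDiff

noncomputable section

namespace TangentSubbundle

/-- A (not necessarily smooth) choice of a linear subspace of each tangent space of `M`. -/
abbrev Distribution (E : Type*) [NormedAddCommGroup E] [NormedSpace ℝ E]
    (M : Type*) [TopologicalSpace M] [ChartedSpace E M] : Type _ :=
  (p : M) → Submodule ℝ (TangentSpace 𝓘(ℝ, E) p)

variable {E : Type*} [NormedAddCommGroup E] [NormedSpace ℝ E]
  {M : Type*} [TopologicalSpace M] [ChartedSpace E M]

section Subbundles

variable [IsManifold 𝓘(ℝ, E) ∞ M]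

/-- The vector field `X` is smooth on a neighbourhood of `p`. -/
def SmoothNear (X : (q : M) → TangentSpace 𝓘(ℝ, E) q) (p : M) : Prop :=
  ∀ᶠ q in 𝓝 p, ContMDiffAt 𝓘(ℝ, E) 𝓘(ℝ, E).tangent ∞
    (fun x : M => (⟨x, X x⟩ : TangentBundle 𝓘(ℝ, E) M)) q

/-- `H` is a `C^∞` vector subbundle of `TM`: near every point it is spanned by a finite smooth
frame. -/
def IsSmoothSubbundle (H : Distribution E M) : Prop :=
  ∀ p : M, ∃ (n : ℕ) (X : Fin n → (q : M) → TangentSpace 𝓘(ℝ, E) q),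
    (∀ i, SmoothNear (X i) p) ∧
    ∀ᶠ q in 𝓝 p, LinearIndependent ℝ (fun i => X i q) ∧
      Submodule.span ℝ (range fun i => X i q) = H q

/-- `X` is, on a neighbourhood of `p`, a smooth section of `H`. -/
def IsSectionNear (H : Distribution E M) (X : (q : M) → TangentSpace 𝓘(ℝ, E) q) (p : M) : Prop :=
  SmoothNear X p ∧ ∀ᶠ q in 𝓝 p, X q ∈ H q

end Subbundles

section Curvature

variable [IsManifold 𝓘(ℝ, E) ∞ M]

/-- `C`, an element of `Hom (H_p ∧ H_p, T_p M / H_p)`, satisfies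
`C (X_p ∧ Y_p) = [X, Y]_p mod H_p` for all smooth sections `X`, `Y` of `H` near `p`. -/
def IsCurvatureAt (H : Distribution E M) (p : M)
    (C : (H p) [⋀^Fin 2]→ₗ[ℝ] (TangentSpace 𝓘(ℝ, E) p ⧸ H p)) : Prop :=
  ∀ (X Y : (q : M) → TangentSpace 𝓘(ℝ, E) q) (u v : H p),
    IsSectionNear H X p → IsSectionNear H Y p → X p = u → Y p = v →
      C ![u, v] = (H p).mkQ (VectorField.mlieBracket 𝓘(ℝ, E) X Y p)

open Classical in
/-- The curvature tensor `C^H_p` of `H` at `p`, as an alternating bilinear map on `H_p` with values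
in `T_p M / H_p`. (For a smooth subbundle there is exactly one map as in `IsCurvatureAt`.) -/
def curvature (H : Distribution E M) (p : M) :
    (H p) [⋀^Fin 2]→ₗ[ℝ] (TangentSpace 𝓘(ℝ, E) p ⧸ H p) :=
  if h : ∃ C, IsCurvatureAt H p C then h.choose else 0

end Curvature

section DoubleTangent

variable [IsManifold 𝓘(ℝ, E) ∞ M]

variable (E M) in
/-- The double tangent bundle `T(TM)`. -/
abbrev DoubleTangent : Type _ :=
  TangentBundle 𝓘(ℝ, E).tangent (TangentBundle 𝓘(ℝ, E) M)

/-- The canonical involution `ω_M` of `T(TM)`. A vector tangent to `TM` at `(p, y)` is given in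
Mathlib by its coordinates `(u, v)` in the chart of `TM` induced by the preferred chart of `M`
at `p`; this chart of `TM` depends on `p` only, and the involution is
`(x, y; u, v) ↦ (x, u; y, v)`. -/
def canonicalFlip (W : DoubleTangent E M) : DoubleTangent E M :=
  ⟨⟨W.proj.proj, (W.snd : E × E).1⟩, ((W.proj.snd : E), (W.snd : E × E).2)⟩

/-- The total space of `H`, as a subset of `TM`. -/
def totalSpace (H : Distribution E M) : Set (TangentBundle 𝓘(ℝ, E) M) :=
  {k | k.snd ∈ H k.proj}

/-- The tangent bundle `TH ⊆ T(TM)` of the total space of a subbundle `H ⊆ TM`: the set of all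
velocities of smooth curves of `TM` lying in `H`. -/
def tangentToTotalSpace (H : Distribution E M) : Set (DoubleTangent E M) :=
  {W | ∃ c : ℝ → TangentBundle 𝓘(ℝ, E) M,
    ContMDiffAt 𝓘(ℝ, ℝ) 𝓘(ℝ, E).tangent ∞ c 0 ∧ (∀ᶠ s in 𝓝 (0 : ℝ), c s ∈ totalSpace H) ∧
    W = ⟨c 0, mfderiv 𝓘(ℝ, ℝ) 𝓘(ℝ, E).tangent c 0 (1 : ℝ)⟩}

end DoubleTangent

section Transport

/-- The velocity `dβ/dt` at time `t` of a path `β` defined on `J ⊆ ℝ`. -/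
def velocity (β : ℝ → M) (J : Set ℝ) (t : ℝ) : TangentSpace 𝓘(ℝ, E) (β t) :=
  mfderivWithin 𝓘(ℝ, ℝ) 𝓘(ℝ, E) β J t (1 : ℝ)

variable [IsManifold 𝓘(ℝ, E) ∞ M]

/-- `σ` is a parallel section, over the interval `J`, of the bundle `β^* K`, for the linear
connection whose horizontal subspace at `k ∈ K` consists of the vectors that are sent to
`T_k K ∩ ω_M (T H)` by the tangent map of the canonical map `β^* K → K ⊆ TM`. -/
def IsParallel (H K : Distribution E M) (β : ℝ → M) (J : Set ℝ)
    (σ : (t : ℝ) → TangentSpace 𝓘(ℝ, E) (β t)) : Prop :=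
  (∀ t ∈ J, σ t ∈ K (β t)) ∧
  MDifferentiableOn 𝓘(ℝ, ℝ) 𝓘(ℝ, E).tangent
    (fun t => (⟨β t, σ t⟩ : TangentBundle 𝓘(ℝ, E) M)) J ∧
  ∀ t ∈ J,
    (⟨⟨β t, σ t⟩, mfderivWithin 𝓘(ℝ, ℝ) 𝓘(ℝ, E).tangent
        (fun r => (⟨β r, σ r⟩ : TangentBundle 𝓘(ℝ, E) M)) J t (1 : ℝ)⟩ : DoubleTangent E M) ∈
      tangentToTotalSpace K ∩ canonicalFlip '' tangentToTotalSpace H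

/-- The linear map `τ` carries every `w ∈ K_{β s}` to the value at `t` of a parallel section
equal to `w` at `s`. -/
def IsTransport (H K : Distribution E M) (β : ℝ → M) (J : Set ℝ) (s t : ℝ)
    (τ : K (β s) →ₗ[ℝ] K (β t)) : Prop :=
  ∀ w : K (β s), ∃ σ : (r : ℝ) → TangentSpace 𝓘(ℝ, E) (β r),
    IsParallel H K β J σ ∧ σ s = w ∧ σ t = τ w

open Classical in
/-- The parallel transport `(β^* K)_s^t : K_{β s} → K_{β t}`. (There is exactly one map as in
`IsTransport` if `H`, `K` are complementary smooth subbundles and `β` is tangent to `H`.) -/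
def transport (H K : Distribution E M) (β : ℝ → M) (J : Set ℝ) (s t : ℝ) :
    K (β s) →ₗ[ℝ] K (β t) :=
  if h : ∃ τ, IsTransport H K β J s t τ then h.choose else 0

/-- The isomorphism `Q^H_K : T_p M / H_p ≃ K_p` for a complement `K` of `H`. -/
def quotientIso (H K : Distribution E M) (hHK : ∀ p, IsCompl (H p) (K p)) (p : M) :
    (TangentSpace 𝓘(ℝ, E) p ⧸ H p) ≃ₗ[ℝ] K p :=
  Submodule.quotientEquivOfIsCompl (H p) (K p) (hHK p)

/-- The projection `P^K_H : T_p M → H_p` along a complement `K` of `H`. -/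
def projAlong (H K : Distribution E M) (hHK : ∀ p, IsCompl (H p) (K p)) (p : M) :
    TangentSpace 𝓘(ℝ, E) p →ₗ[ℝ] H p :=
  Submodule.projectionOnto (H p) (K p) (hHK p)

/-- The transport `[β^* K]_s^t : T_{β s} M / H_{β s} → T_{β t} M / H_{β t}` induced on the
quotients. -/
def quotientTransport (H K : Distribution E M) (hHK : ∀ p, IsCompl (H p) (K p))
    (β : ℝ → M) (J : Set ℝ) (s t : ℝ) :
    (TangentSpace 𝓘(ℝ, E) (β s) ⧸ H (β s)) →ₗ[ℝ] (TangentSpace 𝓘(ℝ, E) (β t) ⧸ H (β t)) :=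
  (quotientIso H K hHK (β t)).symm.toLinearMap ∘ₗ transport H K β J s t ∘ₗ
    (quotientIso H K hHK (β s)).toLinearMap

end Transport

end TangentSubbundle

end

noncomputable section

namespace TangentSubbundle

/-! ### Linear differential equations on an interval, end points included. -/

section LinearODE

/-! In a chart, write `H` as the kernel of a smooth family of surjections `A x` onto `ℝ^m`, and a
complement `K` as the range of a smooth right inverse `S x` (`exists_isAdapted`). Let `b` be the
coordinate path and `y` the coordinates of a section of `K` along it. The flipped velocity is `(b,
b'; y, y')`, and its tangency to `H` means `A b' = 0` and `dA(y) b' + A y' = 0`. Hence `w = A y`,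
which represents the class of the section modulo `H`, satisfies the linear equation `w' = Γ w` with
`Γ w = dA(b')(S w) - dA(S w)(b')` (`IsAdapted.isParallelAt_iff`). Existence and uniqueness of
transport on all of the interval follow by patching local solutions (`isFlat_isParallelAt`).

Two complements of `H` can share the same `A` (`IsAdapted.change`), so they differ only through
right inverses `S`, `S'`. Moving a solution `w` of the second equation back by the first transport
and differentiating gives `(Γ' - Γ) w` (`hasDerivWithinAt_quotientTransport`). This is `dA(b') h -
dA(h) b'` with `h = S' w - S w`, a vector of `ker A = H`: it is the projection of `S' w` onto `H`
along the first complement.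

Finally, if `X` and `Y` are sections of `H`, differentiating `A X = A Y = 0` gives `A [X, Y] = dA(Y)
X - dA(X) Y`, so the same expression is the curvature of `h` and `b'` (`IsAdapted.curvature_eq`). -/

lemma exists_left_end {J : Set ℝ} (hJ : J.OrdConnected) {c : ℝ} (hc : c ∈ J) {η : ℝ} (hη : 0 < η) :
    ∃ a ∈ J, a ≤ c ∧ c - a < η ∧ ∃ ε > 0, ∀ t ∈ J, c - ε < t → a ≤ t := by
  -- If `c` is the left end point of `J`, then `a = c` is forced. In both cases the last clause
  -- makes the half-line to the right of `a` a neighbourhood of `c` within `J`.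
  by_cases h : ∃ a ∈ J, a < c
  · obtain ⟨a, ha, hac⟩ := h
    refine ⟨max a (c - η / 2), hJ.out ha hc ⟨le_max_left _ _, max_le hac.le (by linarith)⟩,
      max_le hac.le (by linarith), ?_, min (c - a) (η / 2), lt_min (by linarith) (by linarith), ?_⟩
    · linarith [le_max_right a (c - η / 2)]
    · intro t _ h'
      have h1 := min_le_left (c - a) (η / 2)
      have h2 := min_le_right (c - a) (η / 2)
      exact max_le (by linarith) (by linarith)
  · push Not at h
    exact ⟨c, hc, le_rfl, by simpa using hη, 1, one_pos, fun t ht _ => h t ht⟩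

lemma exists_right_end {J : Set ℝ} (hJ : J.OrdConnected) {c : ℝ} (hc : c ∈ J) {η : ℝ}
    (hη : 0 < η) :
    ∃ b ∈ J, c ≤ b ∧ b - c < η ∧ ∃ ε > 0, ∀ t ∈ J, t < c + ε → t ≤ b := by
  by_cases h : ∃ b ∈ J, c < b
  · obtain ⟨b, hb, hcb⟩ := h
    refine ⟨min b (c + η / 2), hJ.out hc hb ⟨le_min hcb.le (by linarith), min_le_left _ _⟩,
      le_min hcb.le (by linarith), ?_, min (b - c) (η / 2), lt_min (by linarith) (by linarith), ?_⟩
    · linarith [min_le_right b (c + η / 2)]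
    · intro t _ h'
      have h1 := min_le_left (b - c) (η / 2)
      have h2 := min_le_right (b - c) (η / 2)
      exact le_min (by linarith) (by linarith)
  · push Not at h
    exact ⟨c, hc, le_rfl, by simpa using hη, 1, one_pos, fun t ht _ => h t ht⟩

/-- Local existence for linear differential equations on an interval, up to its end points. -/
theorem exists_hasDerivWithinAt_linear {X : Type*} [NormedAddCommGroup X] [NormedSpace ℝ X]
    [CompleteSpace X] {J : Set ℝ} (hJ : J.OrdConnected) {c : ℝ} (hc : c ∈ J) {N : Set ℝ}
    (hN : N ∈ 𝓝 c) (G : ℝ → X →L[ℝ] X) (hG : ContinuousOn G (J ∩ N)) (x₀ : X) :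
    ∃ ε > 0, ∃ α : ℝ → X, α c = x₀ ∧
      ∀ t ∈ J ∩ Ioo (c - ε) (c + ε), HasDerivWithinAt α (G t (α t)) J t := by
  have hcN : c ∈ J ∩ N := ⟨hc, mem_of_mem_nhds hN⟩
  have hbd : ∀ᶠ t in 𝓝[J] c, ‖G t‖ < ‖G c‖ + 1 ∧ t ∈ N := by
    have h1 : ∀ᶠ t in 𝓝[J ∩ N] c, ‖G t‖ < ‖G c‖ + 1 :=
      (hG c hcN).norm.eventually_lt_const (lt_add_one _)
    rw [nhdsWithin_inter_of_mem' (mem_nhdsWithin_of_mem_nhds hN)] at h1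
    exact h1.and (mem_nhdsWithin_of_mem_nhds hN)
  obtain ⟨δ, hδ, hball⟩ := Metric.mem_nhdsWithin_iff.1 hbd
  set C : ℝ := ‖G c‖ + 1 with hC
  have hC0 : 0 < C := by positivity
  -- `Lc` bounds the right-hand side on the ball of radius 1 about `x₀`; keeping the time interval
  -- within `1 / Lc` of `c` prevents solutions from leaving that ball.
  set Lc : ℝ := C * (‖x₀‖ + 1) with hLc
  have hL0 : 0 < Lc := by positivity
  have hη : 0 < min δ (1 / Lc) := lt_min hδ (by positivity)
  obtain ⟨a, haJ, hac, had, ε₁, hε₁, ha⟩ := exists_left_end hJ hc hη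
  obtain ⟨b, hbJ, hcb, hbd', ε₂, hε₂, hb⟩ := exists_right_end hJ hc hη
  have hsub : ∀ t ∈ Icc a b, t ∈ J ∩ N ∧ ‖G t‖ ≤ C := by
    intro t ht
    have htJ := hJ.out haJ hbJ ht
    have := hball ⟨by
      rw [Metric.mem_ball, Real.dist_eq, abs_lt]
      have := min_le_left δ (1 / Lc)
      constructor <;> linarith [ht.1, ht.2], htJ⟩
    exact ⟨⟨htJ, this.2⟩, this.1.le⟩
  have hPL : IsPicardLindelof (fun t x => G t x) (⟨c, hac, hcb⟩ : Icc a b) x₀ 1 0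
      ⟨Lc, hL0.le⟩ ⟨C, hC0.le⟩ := by
    refine ⟨fun t ht => ?_, fun x _ => ?_, fun t ht x hx => ?_, ?_⟩
    · refine (LipschitzWith.of_dist_le_mul fun x y => ?_).lipschitzOnWith
      rw [dist_eq_norm, ← map_sub, dist_eq_norm]
      exact (G t).le_of_opNorm_le (hsub t ht).2 _
    · exact (hG.mono fun t ht => (hsub t ht).1).clm_apply continuousOn_const
    · have hx' : ‖x‖ ≤ ‖x₀‖ + 1 := by
        have h1 : ‖x - x₀‖ ≤ 1 := by simpa [dist_eq_norm] using hx
        have h2 := norm_add_le x₀ (x - x₀)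
        rw [add_sub_cancel] at h2
        linarith
      exact ((G t).le_of_opNorm_le (hsub t ht).2 _).trans
        (mul_le_mul_of_nonneg_left hx' hC0.le)
    · have h1 : max (b - c) (c - a) ≤ 1 / Lc :=
        max_le (hbd'.le.trans (min_le_right _ _)) (had.le.trans (min_le_right _ _))
      have h2 : Lc * max (b - c) (c - a) ≤ 1 := by
        calc _ ≤ Lc * (1 / Lc) := mul_le_mul_of_nonneg_left h1 hL0.le
          _ = 1 := by field_simp
      rw [NNReal.coe_one, NNReal.coe_zero, sub_zero]
      exact h2
  obtain ⟨α, hα0, hα⟩ := hPL.exists_eq_forall_mem_Icc_hasDerivWithinAt₀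
  refine ⟨min ε₁ ε₂, lt_min hε₁ hε₂, α, hα0, fun t ht => ?_⟩
  have hle : ∀ s ∈ J ∩ Ioo (c - min ε₁ ε₂) (c + min ε₁ ε₂), s ∈ Icc a b := fun s hs =>
    ⟨ha s hs.1 (by linarith [min_le_left ε₁ ε₂, hs.2.1]),
      hb s hs.1 (by linarith [min_le_right ε₁ ε₂, hs.2.2])⟩
  exact (hα t (hle t ht)).mono_of_mem_nhdsWithin
    (mem_of_superset (inter_mem_nhdsWithin J (isOpen_Ioo.mem_nhds ht.2)) hle)

/-- A function with vanishing derivative on an interval is constant. -/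
theorem eqOn_of_hasDerivWithinAt_zero {X : Type*} [NormedAddCommGroup X] [NormedSpace ℝ X]
    {J : Set ℝ} (hJ : J.OrdConnected) {f : ℝ → X} (hf : ∀ t ∈ J, HasDerivWithinAt f 0 J t)
    {s t : ℝ} (hs : s ∈ J) (ht : t ∈ J) : f s = f t := by
  have h := hJ.convex.norm_image_sub_le_of_norm_hasDerivWithin_le (C := 0) hf (by simp) ht hs
  rw [zero_mul, norm_le_zero_iff, sub_eq_zero] at h
  exact h

/-- A linear differential equation has, locally, a fundamental solution and an inverse of it. -/
theorem exists_fundamental_solution {F : Type*} [NormedAddCommGroup F] [NormedSpace ℝ F]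
    [FiniteDimensional ℝ F] {J : Set ℝ} (hJ : J.OrdConnected) {c : ℝ} (hc : c ∈ J) {N : Set ℝ}
    (hN : N ∈ 𝓝 c) (Θ : ℝ → F →L[ℝ] F) (hΘ : ContinuousOn Θ (J ∩ N)) :
    ∃ ε > 0, ∃ Φ Ψ : ℝ → F →L[ℝ] F, Φ c = 1 ∧ Ψ c = 1 ∧
      (∀ t ∈ J ∩ Ioo (c - ε) (c + ε), HasDerivWithinAt Φ (Θ t * Φ t) J t) ∧
      (∀ t ∈ J ∩ Ioo (c - ε) (c + ε), HasDerivWithinAt Ψ (-(Ψ t * Θ t)) J t) ∧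
      ∀ t ∈ J ∩ Ioo (c - ε) (c + ε), Ψ t * Φ t = 1 ∧ Φ t * Ψ t = 1 := by
  have := FiniteDimensional.complete ℝ F
  obtain ⟨ε₁, hε₁, Φ, hΦ0, hΦ⟩ := exists_hasDerivWithinAt_linear hJ hc hN
    (fun t => ContinuousLinearMap.mul ℝ (F →L[ℝ] F) (Θ t))
    ((ContinuousLinearMap.mul ℝ (F →L[ℝ] F)).continuous.comp_continuousOn hΘ) 1
  obtain ⟨ε₂, hε₂, Ψ, hΨ0, hΨ⟩ := exists_hasDerivWithinAt_linear hJ hc hN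
    (fun t => -(ContinuousLinearMap.mul ℝ (F →L[ℝ] F)).flip (Θ t))
    (((ContinuousLinearMap.mul ℝ (F →L[ℝ] F)).flip.continuous.comp_continuousOn hΘ).neg) 1
  have hJε : (J ∩ Ioo (c - min ε₁ ε₂) (c + min ε₁ ε₂)).OrdConnected := hJ.inter ordConnected_Ioo
  have hsub1 : ∀ t ∈ J ∩ Ioo (c - min ε₁ ε₂) (c + min ε₁ ε₂), t ∈ J ∩ Ioo (c - ε₁) (c + ε₁) :=
    fun t ht => ⟨ht.1, by linarith [min_le_left ε₁ ε₂, ht.2.1],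
      by linarith [min_le_left ε₁ ε₂, ht.2.2]⟩
  have hsub2 : ∀ t ∈ J ∩ Ioo (c - min ε₁ ε₂) (c + min ε₁ ε₂), t ∈ J ∩ Ioo (c - ε₂) (c + ε₂) :=
    fun t ht => ⟨ht.1, by linarith [min_le_right ε₁ ε₂, ht.2.1],
      by linarith [min_le_right ε₁ ε₂, ht.2.2]⟩
  have hΦ' : ∀ t ∈ J ∩ Ioo (c - min ε₁ ε₂) (c + min ε₁ ε₂),
      HasDerivWithinAt Φ (Θ t * Φ t) J t := fun t ht => hΦ t (hsub1 t ht)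
  have hΨ' : ∀ t ∈ J ∩ Ioo (c - min ε₁ ε₂) (c + min ε₁ ε₂),
      HasDerivWithinAt Ψ (-(Ψ t * Θ t)) J t := fun t ht => by
    simpa using hΨ t (hsub2 t ht)
  refine ⟨min ε₁ ε₂, lt_min hε₁ hε₂, Φ, Ψ, hΦ0, hΨ0, hΦ', hΨ', fun t ht => ?_⟩
  -- The product has derivative `-ΨΘΦ + ΨΘΦ = 0`, and it equals 1 at `c`.
  have hmul : Ψ t * Φ t = 1 := by
    have hc' : c ∈ J ∩ Ioo (c - min ε₁ ε₂) (c + min ε₁ ε₂) :=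
      ⟨hc, by constructor <;> linarith [lt_min hε₁ hε₂]⟩
    have := eqOn_of_hasDerivWithinAt_zero hJε (f := fun t => Ψ t * Φ t) (fun r hr => by
      have h := ((hΨ' r hr).mul (hΦ' r hr)).mono (inter_subset_left (t := Ioo (c - min ε₁ ε₂)
        (c + min ε₁ ε₂)))
      convert! h using 1
      noncomm_ring) ht hc'
    simpa [hΦ0, hΨ0] using this
  refine ⟨hmul, ?_⟩
  -- In finite dimension a one-sided inverse of an endomorphism is two-sided.
  have h1 : (Ψ t : F →ₗ[ℝ] F) * (Φ t : F →ₗ[ℝ] F) = 1 := by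
    ext x; exact congrArg (fun T : F →L[ℝ] F => T x) hmul
  have h2 := mul_eq_one_comm.1 h1
  ext x
  exact congrArg (fun T : F →ₗ[ℝ] F => T x) h2

end LinearODE

/-! ### Patching local solutions of a flat system over an interval. -/

section FlatSystem

variable {B : ℝ → Type*} [∀ r, AddCommGroup (B r)] [∀ r, Module ℝ (B r)]

/-- A local condition `P` on the sections over an interval `J` of a family of vector spaces
defines a flat connection: locally, its solutions are the sections that are constant in a suitable
trivialization of the subspaces `K r`. -/
structure IsFlat (J : Set ℝ) (K : ∀ r, Submodule ℝ (B r)) (P : (∀ r, B r) → ℝ → Prop) :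
    Prop where
  mem : ∀ {σ t}, P σ t → σ t ∈ K t
  congr : ∀ {σ σ' t}, t ∈ J → (∀ᶠ r in 𝓝[J] t, σ r = σ' r) → P σ t → P σ' t
  exists_trivialization : ∀ c ∈ J, ∃ ε > 0, ∃ (m : ℕ) (a : ∀ r, B r →ₗ[ℝ] (Fin m → ℝ))
    (b : ∀ r, (Fin m → ℝ) →ₗ[ℝ] B r),
    (∀ t ∈ J ∩ Ioo (c - ε) (c + ε), (∀ w, b t w ∈ K t) ∧ (∀ w, a t (b t w) = w) ∧
      (∀ k ∈ K t, b t (a t k) = k) ∧ ∀ w, P (fun r => b r w) t) ∧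
    ∀ (σ : ∀ r, B r) (U : Set ℝ), IsOpen U → U.OrdConnected → U ⊆ Ioo (c - ε) (c + ε) →
      (∀ t ∈ J ∩ U, P σ t) → ∀ s ∈ J ∩ U, ∀ t ∈ J ∩ U, a s (σ s) = a t (σ t)

variable {J : Set ℝ} {K : ∀ r, Submodule ℝ (B r)} {P : (∀ r, B r) → ℝ → Prop}

namespace IsFlat

/-- Near `x` every solution is the image under `b` of a constant vector, so agreement at `x` is
equivalent to agreement at nearby points, and connectedness of `J ∩ U` propagates it. The interval
`U` is needed because solutions are compared before they are known to exist globally. -/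
theorem eq_of_eq (h : IsFlat J K P) (hJ : J.OrdConnected) {U : Set ℝ} (hU : IsOpen U)
    (hU' : U.OrdConnected) {σ₁ σ₂ : ∀ r, B r} (h₁ : ∀ t ∈ J ∩ U, P σ₁ t)
    (h₂ : ∀ t ∈ J ∩ U, P σ₂ t) {s t : ℝ} (hs : s ∈ J ∩ U) (ht : t ∈ J ∩ U)
    (he : σ₁ s = σ₂ s) : σ₁ t = σ₂ t := by
  refine ((hJ.inter hU').isPreconnected.induction₂ (fun x y => σ₁ x = σ₂ x ↔ σ₁ y = σ₂ y) ?_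
    (fun _ _ _ _ _ _ => Iff.trans) (fun _ _ _ _ => Iff.symm) hs ht).1 he
  intro x hx
  obtain ⟨ε, hε, m, a, b, hab, hconst⟩ := h.exists_trivialization x hx.1
  set V := Ioo (x - ε) (x + ε) ∩ U
  have hV : IsOpen V := isOpen_Ioo.inter hU
  have hxV : x ∈ V := ⟨by constructor <;> linarith, hx.2⟩
  have hVc : V.OrdConnected := ordConnected_Ioo.inter hU'
  have key : ∀ σ : ∀ r, B r, (∀ t ∈ J ∩ U, P σ t) → ∀ y ∈ J ∩ V, ∀ z ∈ J ∩ V,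
      σ y = b y (a z (σ z)) := fun σ hσ y hy z hz => by
    rw [← hconst σ V hV hVc inter_subset_left (fun t ht => hσ t ⟨ht.1, ht.2.2⟩) y hy z hz]
    exact ((hab y ⟨hy.1, hy.2.1⟩).2.2.1 _ (h.mem (hσ y ⟨hy.1, hy.2.2⟩))).symm
  have hev : ∀ᶠ y in 𝓝[J ∩ U] x, y ∈ J ∩ V :=
    mem_of_superset (inter_mem_nhdsWithin (J ∩ U) (hV.mem_nhds hxV)) fun y hy => ⟨hy.1.1, hy.2⟩
  filter_upwards [hev] with y hy
  constructor
  · intro h'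
    rw [key σ₁ h₁ y hy x ⟨hx.1, hxV⟩, key σ₂ h₂ y hy x ⟨hx.1, hxV⟩, h']
  · intro h'
    rw [key σ₁ h₁ x ⟨hx.1, hxV⟩ y hy, key σ₂ h₂ x ⟨hx.1, hxV⟩ y hy, h']

/-- Through every vector over `V` passes a solution over `V`. -/
def SolvableOn (J : Set ℝ) (K : ∀ r, Submodule ℝ (B r)) (P : (∀ r, B r) → ℝ → Prop)
    (V : Set ℝ) : Prop :=
  ∀ s ∈ J ∩ V, ∀ w ∈ K s, ∃ σ : ∀ r, B r, σ s = w ∧ ∀ t ∈ J ∩ V, P σ t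

/-- A solution over one interval is continued by the solution over the other that has the same value
at the common point `x`. The overlap is again an interval, so uniqueness makes the two agree there,
and the glued section is locally one of them. -/
theorem SolvableOn.union (h : IsFlat J K P) (hJ : J.OrdConnected) {V₁ V₂ : Set ℝ}
    (hV₁ : IsOpen V₁) (hV₂ : IsOpen V₂) (hc₁ : V₁.OrdConnected) (hc₂ : V₂.OrdConnected)
    {x : ℝ} (hx : x ∈ J ∩ (V₁ ∩ V₂)) (h₁ : SolvableOn J K P V₁) (h₂ : SolvableOn J K P V₂) :
    SolvableOn J K P (V₁ ∪ V₂) := by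
  classical
  have aux : ∀ {U₁ U₂ : Set ℝ}, IsOpen U₁ → IsOpen U₂ → U₁.OrdConnected → U₂.OrdConnected →
      x ∈ J ∩ (U₁ ∩ U₂) → SolvableOn J K P U₁ → SolvableOn J K P U₂ → ∀ s ∈ J ∩ U₁, ∀ w ∈ K s,
      ∃ σ : ∀ r, B r, σ s = w ∧ ∀ t ∈ J ∩ (U₁ ∪ U₂), P σ t := by
    intro U₁ U₂ hU₁ hU₂ hd₁ hd₂ hx k₁ k₂ s hs w hw
    obtain ⟨σ₁, rfl, hP₁⟩ := k₁ s hs w hw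
    obtain ⟨σ₂, he, hP₂⟩ := k₂ x ⟨hx.1, hx.2.2⟩ (σ₁ x) (h.mem (hP₁ x ⟨hx.1, hx.2.1⟩))
    refine ⟨fun r => if r ∈ U₁ then σ₁ r else σ₂ r, by simp [hs.2], ?_⟩
    rintro t ⟨htJ, ht | ht⟩
    · refine h.congr htJ ?_ (hP₁ t ⟨htJ, ht⟩)
      filter_upwards [mem_nhdsWithin_of_mem_nhds (hU₁.mem_nhds ht)] with r hr
      simp [hr]
    · refine h.congr htJ ?_ (hP₂ t ⟨htJ, ht⟩)
      filter_upwards [mem_nhdsWithin_of_mem_nhds (hU₂.mem_nhds ht), self_mem_nhdsWithin]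
        with r hr hrJ
      by_cases hr' : r ∈ U₁
      · simp only [hr', if_true]
        exact h.eq_of_eq hJ (hU₁.inter hU₂) (hd₁.inter hd₂) (fun t ht => hP₂ t ⟨ht.1, ht.2.2⟩)
          (fun t ht => hP₁ t ⟨ht.1, ht.2.1⟩) hx ⟨hrJ, hr', hr⟩ he
      · simp [hr']
  rintro s ⟨hsJ, hs | hs⟩ w hw
  · exact aux hV₁ hV₂ hc₁ hc₂ hx h₁ h₂ s ⟨hsJ, hs⟩ w hw
  · rw [union_comm]
    exact aux hV₂ hV₁ hc₂ hc₁ ⟨hx.1, hx.2.symm⟩ h₂ h₁ s ⟨hsJ, hs⟩ w hw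

/-- Lying in a common solvable interval is a relation that holds between nearby points, is
symmetric, and is transitive by gluing; on a connected set it therefore relates all points. -/
theorem exists_solvableOn (h : IsFlat J K P) (hJ : J.OrdConnected) {s t : ℝ} (hs : s ∈ J)
    (ht : t ∈ J) :
    ∃ V : Set ℝ, IsOpen V ∧ V.OrdConnected ∧ s ∈ V ∧ t ∈ V ∧ SolvableOn J K P V := by
  refine hJ.isPreconnected.induction₂ (fun s t => ∃ V : Set ℝ, IsOpen V ∧ V.OrdConnected ∧
    s ∈ V ∧ t ∈ V ∧ SolvableOn J K P V) ?_ ?_ ?_ hs ht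
  · intro x hx
    obtain ⟨ε, hε, m, a, b, hab, -⟩ := h.exists_trivialization x hx
    have hxV : x ∈ Ioo (x - ε) (x + ε) := by constructor <;> linarith
    filter_upwards [mem_nhdsWithin_of_mem_nhds (isOpen_Ioo.mem_nhds hxV)] with y hy
    refine ⟨_, isOpen_Ioo, ordConnected_Ioo, hxV, hy, fun s hs w hw => ?_⟩
    exact ⟨fun r => b r (a s w), (hab s hs).2.2.1 w hw, fun t ht => (hab t ht).2.2.2 _⟩
  · rintro x y z hx hy hz ⟨V₁, hV₁, hc₁, hx₁, hy₁, h₁⟩ ⟨V₂, hV₂, hc₂, hy₂, hz₂, h₂⟩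
    refine ⟨V₁ ∪ V₂, hV₁.union hV₂, ?_, Or.inl hx₁, Or.inr hz₂,
      SolvableOn.union h hJ hV₁ hV₂ hc₁ hc₂ ⟨hy, hy₁, hy₂⟩ h₁ h₂⟩
    exact (hc₁.isPreconnected.union y hy₁ hy₂ hc₂.isPreconnected).ordConnected
  · rintro x y - - ⟨V, hV, hc, hx, hy, h'⟩
    exact ⟨V, hV, hc, hy, hx, h'⟩

/-- Global existence of solutions. -/
theorem exists_solution (h : IsFlat J K P) (hJ : J.OrdConnected) {s : ℝ} (hs : s ∈ J) {w : B s}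
    (hw : w ∈ K s) : ∃ σ : ∀ r, B r, σ s = w ∧ ∀ t ∈ J, P σ t := by
  classical
  have hloc : ∀ t ∈ J, ∃ (V : Set ℝ) (σ : ∀ r, B r), IsOpen V ∧ V.OrdConnected ∧ s ∈ V ∧ t ∈ V ∧
      σ s = w ∧ ∀ r ∈ J ∩ V, P σ r := by
    intro t ht
    obtain ⟨V, hV, hc, hsV, htV, hsol⟩ := h.exists_solvableOn hJ hs ht
    obtain ⟨σ, hσ, hP⟩ := hsol s ⟨hs, hsV⟩ w hw
    exact ⟨V, σ, hV, hc, hsV, htV, hσ, hP⟩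
  choose! V σ hV hc hsV htV hσ hP using hloc
  -- The local solutions all take the value `w` at `s`, so by uniqueness the diagonal section
  -- coincides near `t` with the solution chosen for `t`.
  refine ⟨fun r => σ r r, hσ s hs, fun t ht => ?_⟩
  refine h.congr ht ?_ (hP t ht t ⟨ht, htV t ht⟩)
  filter_upwards [mem_nhdsWithin_of_mem_nhds ((hV t ht).mem_nhds (htV t ht)),
    self_mem_nhdsWithin] with r hr hrJ
  exact h.eq_of_eq hJ ((hV t ht).inter (hV r hrJ)) ((hc t ht).inter (hc r hrJ))
    (fun x hx => hP t ht x ⟨hx.1, hx.2.1⟩) (fun x hx => hP r hrJ x ⟨hx.1, hx.2.2⟩)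
    ⟨hs, hsV t ht, hsV r hrJ⟩ ⟨hrJ, hr, htV r hrJ⟩ ((hσ t ht).trans (hσ r hrJ).symm)

theorem eq_of_eq' (h : IsFlat J K P) (hJ : J.OrdConnected) {σ₁ σ₂ : ∀ r, B r}
    (h₁ : ∀ t ∈ J, P σ₁ t) (h₂ : ∀ t ∈ J, P σ₂ t) {s t : ℝ} (hs : s ∈ J) (ht : t ∈ J)
    (he : σ₁ s = σ₂ s) : σ₁ t = σ₂ t :=
  h.eq_of_eq hJ isOpen_univ ordConnected_univ (fun t ht => h₁ t ht.1) (fun t ht => h₂ t ht.1)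
    ⟨hs, trivial⟩ ⟨ht, trivial⟩ he

/-- Solutions form a vector space. -/
theorem linear_comb (h : IsFlat J K P) {σ₁ σ₂ : ∀ r, B r} (h₁ : ∀ t ∈ J, P σ₁ t)
    (h₂ : ∀ t ∈ J, P σ₂ t) (k : ℝ) : ∀ t ∈ J, P (fun r => k • σ₁ r + σ₂ r) t := by
  intro t ht
  obtain ⟨ε, hε, m, a, b, hab, hconst⟩ := h.exists_trivialization t ht
  have htV : t ∈ Ioo (t - ε) (t + ε) := by constructor <;> linarith
  refine h.congr ht ?_ ((hab t ⟨ht, htV⟩).2.2.2 (k • a t (σ₁ t) + a t (σ₂ t)))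
  filter_upwards [mem_nhdsWithin_of_mem_nhds (isOpen_Ioo.mem_nhds htV), self_mem_nhdsWithin]
    with r hr hrJ
  have key : ∀ σ : ∀ r, B r, (∀ t ∈ J, P σ t) → b r (a t (σ t)) = σ r := fun σ hσ => by
    rw [← hconst σ _ isOpen_Ioo ordConnected_Ioo subset_rfl (fun t ht => hσ t ht.1) r
      ⟨hrJ, hr⟩ t ⟨ht, htV⟩]
    exact (hab r ⟨hrJ, hr⟩).2.2.1 _ (h.mem (hσ r hrJ))
  rw [map_add, map_smul, key σ₁ h₁, key σ₂ h₂]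

/-- There is a linear map that transports along solutions. -/
theorem exists_linearMap (h : IsFlat J K P) (hJ : J.OrdConnected) {s t : ℝ} (hs : s ∈ J)
    (ht : t ∈ J) : ∃ τ : K s →ₗ[ℝ] K t, ∀ w : K s, ∃ σ : ∀ r, B r,
      (∀ r ∈ J, P σ r) ∧ σ s = w ∧ σ t = τ w := by
  choose σ hσ hP using fun w : K s => h.exists_solution hJ hs w.2
  refine ⟨{ toFun := fun w => ⟨σ w t, h.mem (hP w t ht)⟩, map_add' := ?_, map_smul' := ?_ },
    fun w => ⟨σ w, hP w, hσ w, rfl⟩⟩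
  · intro w₁ w₂
    refine Subtype.ext ?_
    have := h.eq_of_eq' hJ (hP (w₁ + w₂)) (h.linear_comb (hP w₁) (hP w₂) 1) hs ht
      (by simp [hσ])
    simpa using this
  · intro k w
    refine Subtype.ext ?_
    -- `linear_comb` always adds a second solution; here it is the zero section, written as `-σ +
    -- σ`.
    have h0 : ∀ r ∈ J, P (fun r => k • σ w r + ((-1 : ℝ) • σ w r + σ w r)) r :=
      h.linear_comb (hP w) (h.linear_comb (hP w) (hP w) (-1)) k
    have := h.eq_of_eq' hJ (hP (k • w)) h0 hs ht (by simp [hσ])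
    simpa using this

end IsFlat

end FlatSystem

/-! ### Coordinates on `TM` and `T(TM)`, and the canonical flip. -/

section BundleCharts

variable {E : Type*} [NormedAddCommGroup E] [NormedSpace ℝ E]
  {M : Type*} [TopologicalSpace M] [ChartedSpace E M] [IsManifold 𝓘(ℝ, E) ∞ M]

/-- The coordinates of tangent vectors at `q` in the preferred chart at `p`. -/
def coordMap (p q : M) : TangentSpace 𝓘(ℝ, E) q →L[ℝ] E :=
  tangentCoordChange (E := E) 𝓘(ℝ, E) q p q

/-- The tangent vector at `q` with given coordinates in the preferred chart at `p`. -/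
def coordInv (p q : M) : E →L[ℝ] TangentSpace 𝓘(ℝ, E) q :=
  tangentCoordChange (E := E) 𝓘(ℝ, E) p q q

lemma coordMap_coordInv {p q : M} (hq : q ∈ (extChartAt 𝓘(ℝ, E) p).source) y :
    coordMap (E := E) p q (coordInv p q y) = y := by
  have h := tangentCoordChange_comp (I := 𝓘(ℝ, E)) (w := p) (x := q) (y := p) (z := q) (v := y)
    ⟨⟨hq, mem_extChartAt_source q⟩, hq⟩
  exact h.trans (tangentCoordChange_self hq)

lemma coordInv_coordMap {p q : M} (hq : q ∈ (extChartAt 𝓘(ℝ, E) p).source)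
    (y : TangentSpace 𝓘(ℝ, E) q) : coordInv p q (coordMap p q y) = y := by
  have h := tangentCoordChange_comp (I := 𝓘(ℝ, E)) (w := q) (x := p) (y := q) (z := q) (v := y)
    ⟨⟨mem_extChartAt_source q, hq⟩, mem_extChartAt_source q⟩
  exact h.trans (tangentCoordChange_self (mem_extChartAt_source q))

lemma coordMap_eq_mfderiv {p q : M} (hq : q ∈ (extChartAt 𝓘(ℝ, E) p).source) :
    coordMap p q = mfderiv 𝓘(ℝ, E) 𝓘(ℝ, E) (extChartAt 𝓘(ℝ, E) p) q := by
  rw [extChartAt_source] at hq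
  rw [← TangentBundle.continuousLinearMapAt_trivializationAt hq,
    TangentBundle.continuousLinearMapAt_trivializationAt_eq_core hq]
  rfl

lemma coordMap_injective {p q : M} (hq : q ∈ (extChartAt 𝓘(ℝ, E) p).source) :
    Function.Injective (coordMap (E := E) p q) :=
  Function.LeftInverse.injective (coordInv_coordMap hq)

/-- The chart of `TM` induced by the preferred chart at `p`. -/
def bundleChart (p : M) (k : TangentBundle 𝓘(ℝ, E) M) : E × E :=
  (extChartAt 𝓘(ℝ, E) p k.proj, coordMap p k.proj k.snd)

/-- The inverse of `bundleChart`. -/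
def bundleChartSymm (p : M) (z : E × E) : TangentBundle 𝓘(ℝ, E) M :=
  ⟨(extChartAt 𝓘(ℝ, E) p).symm z.1, coordInv p ((extChartAt 𝓘(ℝ, E) p).symm z.1) z.2⟩

lemma mem_extChartAt_tangent_source (p : M) (k : TangentBundle 𝓘(ℝ, E) M) :
    k ∈ (extChartAt 𝓘(ℝ, E).tangent (⟨p, 0⟩ : TangentBundle 𝓘(ℝ, E) M)).source ↔
      k.proj ∈ (extChartAt 𝓘(ℝ, E) p).source := by
  rw [extChartAt_source, extChartAt_source, TangentBundle.mem_chart_source_iff]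

lemma mem_extChartAt_tangent_target (p : M) (z : E × E) :
    z ∈ (extChartAt 𝓘(ℝ, E).tangent (⟨p, 0⟩ : TangentBundle 𝓘(ℝ, E) M)).target ↔
      z.1 ∈ (extChartAt 𝓘(ℝ, E) p).target := by
  rw [FiberBundle.extChartAt_target, mem_prod, mem_inter_iff]
  refine ⟨fun h => h.1.1, fun h => ⟨⟨h, ?_⟩, trivial⟩⟩
  have := (extChartAt 𝓘(ℝ, E) p).map_target h
  rwa [extChartAt_source] at this

lemma bundleChartSymm_bundleChart {p : M} {k : TangentBundle 𝓘(ℝ, E) M}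
    (hk : k.proj ∈ (extChartAt 𝓘(ℝ, E) p).source) : bundleChartSymm p (bundleChart p k) = k :=
  (extChartAt 𝓘(ℝ, E).tangent (⟨p, 0⟩ : TangentBundle 𝓘(ℝ, E) M)).left_inv
    ((mem_extChartAt_tangent_source p k).2 hk)

lemma bundleChart_bundleChartSymm {p : M} {z : E × E}
    (hz : z.1 ∈ (extChartAt 𝓘(ℝ, E) p).target) : bundleChart p (bundleChartSymm p z) = z :=
  (extChartAt 𝓘(ℝ, E).tangent (⟨p, 0⟩ : TangentBundle 𝓘(ℝ, E) M)).right_inv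
    ((mem_extChartAt_tangent_target p z).2 hz)

lemma contMDiffAt_bundleChart {p : M} {k : TangentBundle 𝓘(ℝ, E) M}
    (hk : k.proj ∈ (extChartAt 𝓘(ℝ, E) p).source) :
    ContMDiffAt 𝓘(ℝ, E).tangent 𝓘(ℝ, E × E) ∞ (bundleChart p) k := by
  have h := (mem_extChartAt_tangent_source p k).2 hk
  rw [extChartAt_source] at h
  exact contMDiffAt_extChartAt' h

lemma contMDiffAt_bundleChartSymm {p : M} {z : E × E}
    (hz : z.1 ∈ (extChartAt 𝓘(ℝ, E) p).target) :
    ContMDiffAt 𝓘(ℝ, E × E) 𝓘(ℝ, E).tangent ∞ (bundleChartSymm p) z := by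
  exact (contMDiffOn_extChartAt_symm (I := 𝓘(ℝ, E).tangent) (n := ∞)
    (⟨p, 0⟩ : TangentBundle 𝓘(ℝ, E) M)).contMDiffAt ((isOpen_extChartAt_target _).mem_nhds
    ((mem_extChartAt_tangent_target p z).2 hz))

lemma mdifferentiableAt_bundleChart {p : M} {k : TangentBundle 𝓘(ℝ, E) M}
    (hk : k.proj ∈ (extChartAt 𝓘(ℝ, E) p).source) :
    MDifferentiableAt 𝓘(ℝ, E).tangent 𝓘(ℝ, E × E) (bundleChart p) k :=
  (contMDiffAt_bundleChart hk).mdifferentiableAt (by simp)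

lemma mdifferentiableAt_bundleChartSymm {p : M} {z : E × E}
    (hz : z.1 ∈ (extChartAt 𝓘(ℝ, E) p).target) :
    MDifferentiableAt 𝓘(ℝ, E × E) 𝓘(ℝ, E).tangent (bundleChartSymm p) z :=
  (contMDiffAt_bundleChartSymm hz).mdifferentiableAt (by simp)

/-- The fibre coordinates of a vector tangent to `TM`, in the chart induced by the preferred chart
at `p`. -/
def doubleCoord (p : M) (W : DoubleTangent E M) : E × E :=
  mfderiv 𝓘(ℝ, E).tangent 𝓘(ℝ, E × E) (bundleChart p) W.proj W.snd

lemma doubleCoord_injective {p : M} {k : TangentBundle 𝓘(ℝ, E) M}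
    (hk : k.proj ∈ (extChartAt 𝓘(ℝ, E) p).source) {a b : TangentSpace 𝓘(ℝ, E).tangent k}
    (h : doubleCoord p ⟨k, a⟩ = doubleCoord p ⟨k, b⟩) : a = b := by
  have h1 := isInvertible_mfderiv_extChartAt (I := 𝓘(ℝ, E).tangent)
    ((mem_extChartAt_tangent_source p k).2 hk)
  exact h1.injective h

lemma doubleCoord_mk_mfderivWithin {p : M} {c : ℝ → TangentBundle 𝓘(ℝ, E) M} {J : Set ℝ} {t : ℝ}
    (hJ : UniqueDiffWithinAt ℝ J t)
    (hc : MDifferentiableWithinAt 𝓘(ℝ, ℝ) 𝓘(ℝ, E).tangent c J t)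
    (ht : (c t).proj ∈ (extChartAt 𝓘(ℝ, E) p).source) :
    doubleCoord p ⟨c t, mfderivWithin 𝓘(ℝ, ℝ) 𝓘(ℝ, E).tangent c J t (1 : ℝ)⟩ =
      derivWithin (fun s => bundleChart p (c s)) J t := by
  have h := mfderiv_comp_mfderivWithin (x := t) (mdifferentiableAt_bundleChart ht) hc
    hJ.uniqueMDiffWithinAt
  rw [mfderivWithin_eq_fderivWithin] at h
  exact (congrArg (fun T : ℝ →L[ℝ] E × E => T 1) h).symm

lemma coordMap_mfderivWithin {p : M} {β : ℝ → M} {J : Set ℝ} {t : ℝ}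
    (hJ : UniqueDiffWithinAt ℝ J t) (hβ : MDifferentiableWithinAt 𝓘(ℝ, ℝ) 𝓘(ℝ, E) β J t)
    (ht : β t ∈ (extChartAt 𝓘(ℝ, E) p).source) :
    coordMap p (β t) (velocity β J t) =
      derivWithin (fun s => extChartAt 𝓘(ℝ, E) p (β s)) J t := by
  have ht' := ht
  rw [extChartAt_source] at ht'
  have h := mfderiv_comp_mfderivWithin (x := t)
    (mdifferentiableAt_extChartAt (I := 𝓘(ℝ, E)) ht') hβ hJ.uniqueMDiffWithinAt
  rw [mfderivWithin_eq_fderivWithin] at h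
  rw [coordMap_eq_mfderiv ht]
  exact (congrArg (fun T : ℝ →L[ℝ] E => T 1) h).symm

lemma contDiffAt_coordChange {p q : M} (hq : q ∈ (extChartAt 𝓘(ℝ, E) p).source) :
    ContDiffAt ℝ ∞ (extChartAt 𝓘(ℝ, E) p ∘ (extChartAt 𝓘(ℝ, E) q).symm)
      (extChartAt 𝓘(ℝ, E) q q) := by
  have h := contDiffWithinAt_ext_coord_change (I := 𝓘(ℝ, E)) (n := ∞) p q
    (y := extChartAt 𝓘(ℝ, E) q q) (by
      rw [PartialEquiv.trans_source'', PartialEquiv.symm_symm, PartialEquiv.symm_target]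
      exact mem_image_of_mem _ ⟨mem_extChartAt_source q, hq⟩)
  rwa [modelWithCornersSelf_coe, range_id] at h

/-- With `φ` the change of charts, `TM` changes coordinates by `(x, y) ↦ (φ x, Dφ_x y)`; the formula
is the derivative of this map in the direction `(u, v)`. -/
lemma doubleCoord_eq {p q : M} (hq : q ∈ (extChartAt 𝓘(ℝ, E) p).source)
    (y u v : E) :
    doubleCoord p (⟨⟨q, y⟩, ((u, v) : E × E)⟩ : DoubleTangent E M) =
      (fderiv ℝ (extChartAt 𝓘(ℝ, E) p ∘ (extChartAt 𝓘(ℝ, E) q).symm) (extChartAt 𝓘(ℝ, E) q q) u,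
        fderiv ℝ (fderiv ℝ (extChartAt 𝓘(ℝ, E) p ∘ (extChartAt 𝓘(ℝ, E) q).symm))
          (extChartAt 𝓘(ℝ, E) q q) u y +
        fderiv ℝ (extChartAt 𝓘(ℝ, E) p ∘ (extChartAt 𝓘(ℝ, E) q).symm)
          (extChartAt 𝓘(ℝ, E) q q) v) := by
  set φ := extChartAt 𝓘(ℝ, E) p ∘ (extChartAt 𝓘(ℝ, E) q).symm with hφ
  set x := extChartAt 𝓘(ℝ, E) q q with hx
  set k : TangentBundle 𝓘(ℝ, E) M := ⟨q, y⟩ with hk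
  have hkx : extChartAt 𝓘(ℝ, E).tangent k k = (x, y) :=
    Prod.ext rfl (tangentCoordChange_self (mem_extChartAt_source q))
  have hsm := contDiffAt_coordChange hq
  have hd1 : HasFDerivAt φ (fderiv ℝ φ x) x := (hsm.differentiableAt (by simp)).hasFDerivAt
  have hd2 : HasFDerivAt (fderiv ℝ φ) (fderiv ℝ (fderiv ℝ φ) x) x :=
    ((hsm.fderiv_right (m := 1) (by norm_cast)).differentiableAt (by simp)).hasFDerivAt
  have hloc : (fun z : E × E => (φ z.1, fderiv ℝ φ z.1 z.2)) =ᶠ[𝓝 (x, y)]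
      writtenInExtChartAt 𝓘(ℝ, E).tangent 𝓘(ℝ, E × E) k (bundleChart p) := by
    have h1 : ∀ᶠ x' in 𝓝 x, x' ∈ (extChartAt 𝓘(ℝ, E) q).target ∧
        (extChartAt 𝓘(ℝ, E) q).symm x' ∈ (extChartAt 𝓘(ℝ, E) p).source := by
      refine Filter.Eventually.and (extChartAt_target_mem_nhds q) ?_
      refine (continuousAt_extChartAt_symm q).eventually ?_
      rw [extChartAt_to_inv]
      exact (isOpen_extChartAt_source p).mem_nhds hq
    filter_upwards [(continuous_fst.tendsto (x, y)).eventually h1] with z hz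
    refine Prod.ext rfl ?_
    have hmem := (extChartAt 𝓘(ℝ, E) q).map_target hz.1
    have h2 := tangentCoordChange_comp (I := 𝓘(ℝ, E)) (w := q)
      (x := (extChartAt 𝓘(ℝ, E) q).symm z.1) (y := p) (z := (extChartAt 𝓘(ℝ, E) q).symm z.1)
      (v := z.2) ⟨⟨hmem, mem_extChartAt_source _⟩, hz.2⟩
    refine Eq.trans ?_ h2.symm
    rw [tangentCoordChange_def, (extChartAt 𝓘(ℝ, E) q).right_inv hz.1, modelWithCornersSelf_coe,
      range_id, fderivWithin_univ]
  have hg : HasFDerivAt (fun z : E × E => (φ z.1, fderiv ℝ φ z.1 z.2)) _ (x, y) :=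
    (HasFDerivAt.comp (g := φ) (x, y) hd1 hasFDerivAt_fst).prodMk
      ((HasFDerivAt.comp (g := fderiv ℝ φ) (x, y) hd2 hasFDerivAt_fst).clm_apply hasFDerivAt_snd)
  have hmf : mfderiv 𝓘(ℝ, E).tangent 𝓘(ℝ, E × E) (bundleChart p) k = fderivWithin ℝ
      (writtenInExtChartAt 𝓘(ℝ, E).tangent 𝓘(ℝ, E × E) k (bundleChart p))
      (range 𝓘(ℝ, E).tangent) (extChartAt 𝓘(ℝ, E).tangent k k) :=
    (mdifferentiableAt_bundleChart (k := k) hq).mfderiv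
  have hrange : range (𝓘(ℝ, E).tangent) = univ := ModelWithCorners.Boundaryless.range_eq_univ
  rw [hrange, fderivWithin_univ, hkx, ← hloc.fderiv_eq, hg.fderiv] at hmf
  refine (congrArg (fun T : E × E →L[ℝ] E × E => T (u, v)) hmf).trans ?_
  simp [add_comm]

/-- The canonical involution has the same coordinate expression in all charts. -/
lemma doubleCoord_canonicalFlip {p : M} {W : DoubleTangent E M}
    (hW : W.proj.proj ∈ (extChartAt 𝓘(ℝ, E) p).source) :
    bundleChart p (canonicalFlip W).proj = ((bundleChart p W.proj).1, (doubleCoord p W).1) ∧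
      doubleCoord p (canonicalFlip W) = ((bundleChart p W.proj).2, (doubleCoord p W).2) := by
  obtain ⟨⟨q, y⟩, ⟨u, v⟩⟩ := W
  have hcoord : ∀ z : TangentSpace 𝓘(ℝ, E) q, coordMap p q z =
      fderiv ℝ (extChartAt 𝓘(ℝ, E) p ∘ (extChartAt 𝓘(ℝ, E) q).symm)
        (extChartAt 𝓘(ℝ, E) q q) (z : E) := by
    intro z
    rw [coordMap, tangentCoordChange_def, modelWithCornersSelf_coe, range_id, fderivWithin_univ]
    rfl
  -- The flip interchanges `u` and `y`. The only term of `doubleCoord_eq` containing both is `D²φ(u,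
  -- y)`, so symmetry of the second derivative makes the flip independent of the chart.
  have hsymm : IsSymmSndFDerivAt ℝ (extChartAt 𝓘(ℝ, E) p ∘ (extChartAt 𝓘(ℝ, E) q).symm)
      (extChartAt 𝓘(ℝ, E) q q) :=
    (contDiffAt_coordChange hW).isSymmSndFDerivAt (by simp; norm_cast)
  have h1 := doubleCoord_eq hW y u v
  have h2 := doubleCoord_eq hW (u : TangentSpace 𝓘(ℝ, E) q) y v
  constructor
  · rw [h1]
    exact Prod.ext rfl (hcoord u)
  · refine h2.trans ?_
    rw [h1]
    exact Prod.ext (hcoord y).symm (congrArg (· + _) (hsymm y u))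

lemma mem_image_canonicalFlip {S : Set (DoubleTangent E M)} {W : DoubleTangent E M} :
    W ∈ canonicalFlip '' S ↔ canonicalFlip W ∈ S :=
  ⟨fun ⟨_, hV, hVW⟩ => hVW ▸ hV, fun h => ⟨_, h, rfl⟩⟩

end BundleCharts

/-! ### Frames of complementary subspaces. -/

section Frames

/-- Juxtaposing the two frames identifies `V` with a product in which `H` and `K` are the coordinate
subspaces; `A` and `S` are later read off from this identification. -/
lemma bijective_coprod_linearCombination {V : Type*} [AddCommGroup V] [Module ℝ V]
    {H K : Submodule ℝ V} (hHK : IsCompl H K) {n m : ℕ} {X : Fin n → V} {Y : Fin m → V}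
    (hX : LinearIndependent ℝ X) (hY : LinearIndependent ℝ Y)
    (hXH : Submodule.span ℝ (range X) = H) (hYK : Submodule.span ℝ (range Y) = K) :
    Function.Bijective ((Fintype.linearCombination ℝ X).coprod (Fintype.linearCombination ℝ Y)) ∧
      (∀ z, (Fintype.linearCombination ℝ X).coprod (Fintype.linearCombination ℝ Y) z ∈ H ↔
        z.2 = 0) ∧
      ∀ z, (Fintype.linearCombination ℝ X).coprod (Fintype.linearCombination ℝ Y) z ∈ K ↔
        z.1 = 0 := by
  have hrX : LinearMap.range (Fintype.linearCombination ℝ X) = H := by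
    rw [Fintype.range_linearCombination, hXH]
  have hrY : LinearMap.range (Fintype.linearCombination ℝ Y) = K := by
    rw [Fintype.range_linearCombination, hYK]
  have hkX : LinearMap.ker (Fintype.linearCombination ℝ X) = ⊥ :=
    LinearMap.ker_eq_bot.2 hX.fintypeLinearCombination_injective
  have hkY : LinearMap.ker (Fintype.linearCombination ℝ Y) = ⊥ :=
    LinearMap.ker_eq_bot.2 hY.fintypeLinearCombination_injective
  have hmX : ∀ a, Fintype.linearCombination ℝ X a ∈ H := fun a => hrX ▸ LinearMap.mem_range_self _ a
  have hmY : ∀ a, Fintype.linearCombination ℝ Y a ∈ K := fun a => hrY ▸ LinearMap.mem_range_self _ a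
  refine ⟨⟨?_, ?_⟩, fun z => ?_, fun z => ?_⟩
  · rw [← LinearMap.ker_eq_bot, LinearMap.ker_coprod_of_disjoint_range _ _
      (by rw [hrX, hrY]; exact hHK.disjoint), hkX, hkY, Submodule.prod_bot]
  · rw [← LinearMap.range_eq_top, LinearMap.range_coprod, hrX, hrY, hHK.sup_eq_top]
  · rw [LinearMap.coprod_apply, Submodule.add_mem_iff_right _ (hmX _)]
    refine ⟨fun h => ?_, fun h => by simp [h]⟩
    have := Submodule.disjoint_def.1 hHK.disjoint _ h (hmY _)
    exact LinearMap.ker_eq_bot'.1 hkY _ this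
  · rw [LinearMap.coprod_apply, Submodule.add_mem_iff_left _ (hmY _)]
    refine ⟨fun h => ?_, fun h => by simp [h]⟩
    have := Submodule.disjoint_def.1 hHK.disjoint _ (hmX _) h
    exact LinearMap.ker_eq_bot'.1 hkX _ this

variable {E : Type*} [NormedAddCommGroup E] [NormedSpace ℝ E]

/-- The continuous linear map `(a, b) ↦ ∑ aᵢ Xᵢ + ∑ bⱼ Yⱼ`. -/
def frameMap {n m : ℕ} (X : Fin n → E) (Y : Fin m → E) :
    ((Fin n → ℝ) × (Fin m → ℝ)) →L[ℝ] E :=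
  (∑ i, ((ContinuousLinearMap.proj i).comp
      (ContinuousLinearMap.fst ℝ (Fin n → ℝ) (Fin m → ℝ))).smulRight (X i)) +
    ∑ j, ((ContinuousLinearMap.proj j).comp
      (ContinuousLinearMap.snd ℝ (Fin n → ℝ) (Fin m → ℝ))).smulRight (Y j)

lemma frameMap_apply {n m : ℕ} (X : Fin n → E) (Y : Fin m → E)
    (z : (Fin n → ℝ) × (Fin m → ℝ)) :
    frameMap X Y z = (Fintype.linearCombination ℝ X).coprod (Fintype.linearCombination ℝ Y) z := by
  simp [frameMap, Fintype.linearCombination_apply]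

lemma contDiffAt_frameMap {G : Type*} [NormedAddCommGroup G] [NormedSpace ℝ G] {n m : ℕ}
    {X : Fin n → G → E} {Y : Fin m → G → E} {x : G} (hX : ∀ i, ContDiffAt ℝ ∞ (X i) x)
    (hY : ∀ j, ContDiffAt ℝ ∞ (Y j) x) :
    ContDiffAt ℝ ∞ (fun y => frameMap (fun i => X i y) (fun j => Y j y)) x := by
  refine ContDiffAt.add (ContDiffAt.sum fun i _ => ?_) (ContDiffAt.sum fun j _ => ?_)
  · exact (ContinuousLinearMap.smulRightL ℝ ((Fin n → ℝ) × (Fin m → ℝ)) E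
      ((ContinuousLinearMap.proj i).comp
        (ContinuousLinearMap.fst ℝ (Fin n → ℝ) (Fin m → ℝ)))).contDiff.contDiffAt.comp x (hX i)
  · exact (ContinuousLinearMap.smulRightL ℝ ((Fin n → ℝ) × (Fin m → ℝ)) E
      ((ContinuousLinearMap.proj j).comp
        (ContinuousLinearMap.snd ℝ (Fin n → ℝ) (Fin m → ℝ)))).contDiff.contDiffAt.comp x (hY j)

end Frames

/-! ### Local equations for a subbundle and a complement. -/

section Adapted

variable {E : Type*} [NormedAddCommGroup E] [NormedSpace ℝ E]
  {M : Type*} [TopologicalSpace M] [ChartedSpace E M] [IsManifold 𝓘(ℝ, E) ∞ M]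

/-- A vector field in the preferred chart at `p`. -/
def coordField (p : M) (X : (q : M) → TangentSpace 𝓘(ℝ, E) q) (x : E) : E :=
  coordMap p ((extChartAt 𝓘(ℝ, E) p).symm x) (X ((extChartAt 𝓘(ℝ, E) p).symm x))

lemma coordField_extChartAt {p q : M} (hq : q ∈ (extChartAt 𝓘(ℝ, E) p).source)
    (X : (q : M) → TangentSpace 𝓘(ℝ, E) q) :
    coordField p X (extChartAt 𝓘(ℝ, E) p q) = coordMap p q (X q) :=
  congrArg (fun q' => coordMap p q' (X q')) ((extChartAt 𝓘(ℝ, E) p).left_inv hq)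

lemma SmoothNear.eventually_contDiffAt {p : M} {X : (q : M) → TangentSpace 𝓘(ℝ, E) q}
    (hX : SmoothNear X p) :
    ∀ᶠ x in 𝓝 (extChartAt 𝓘(ℝ, E) p p), ContDiffAt ℝ ∞ (coordField p X) x := by
  have h1 : ∀ᶠ x in 𝓝 (extChartAt 𝓘(ℝ, E) p p),
      ContMDiffAt 𝓘(ℝ, E) 𝓘(ℝ, E).tangent ∞
        (fun x : M => (⟨x, X x⟩ : TangentBundle 𝓘(ℝ, E) M)) ((extChartAt 𝓘(ℝ, E) p).symm x) := by
    refine (continuousAt_extChartAt_symm p).eventually ?_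
    rw [extChartAt_to_inv]
    exact hX
  have h2 : ∀ᶠ x in 𝓝 (extChartAt 𝓘(ℝ, E) p p), x ∈ (extChartAt 𝓘(ℝ, E) p).target :=
    extChartAt_target_mem_nhds p
  filter_upwards [h1, h2] with x hx hxt
  have h3 : ContMDiffAt 𝓘(ℝ, E) 𝓘(ℝ, E) ∞ (extChartAt 𝓘(ℝ, E) p).symm x :=
    (contMDiffOn_extChartAt_symm p).contMDiffAt ((isOpen_extChartAt_target p).mem_nhds hxt)
  have h4 : ContMDiffAt 𝓘(ℝ, E) 𝓘(ℝ, E × E) ∞ (fun y => bundleChart p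
      (⟨(extChartAt 𝓘(ℝ, E) p).symm y, X ((extChartAt 𝓘(ℝ, E) p).symm y)⟩ :
        TangentBundle 𝓘(ℝ, E) M)) x :=
    ContMDiffAt.comp (I' := 𝓘(ℝ, E).tangent) x
      (contMDiffAt_bundleChart ((extChartAt 𝓘(ℝ, E) p).map_target hxt)) (hx.comp x h3)
  exact (contMDiffAt_iff_contDiffAt.1 h4).snd

/-- Local data for complementary subbundles `H` and `K` in the preferred chart at `p`: a smooth
family `A` of linear surjections with kernel `H`, and a smooth right inverse `S` with range `K`. -/
structure IsAdapted (H K : Distribution E M) (p : M) (Ω : Set E) {m : ℕ}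
    (A : E → E →L[ℝ] (Fin m → ℝ)) (S : E → (Fin m → ℝ) →L[ℝ] E) : Prop where
  isOpen : IsOpen Ω
  subset_target : Ω ⊆ (extChartAt 𝓘(ℝ, E) p).target
  mem : extChartAt 𝓘(ℝ, E) p p ∈ Ω
  contDiffOn_A : ContDiffOn ℝ ∞ A Ω
  contDiffOn_S : ContDiffOn ℝ ∞ S Ω
  A_S : ∀ x ∈ Ω, ∀ w, A x (S x w) = w
  mem_H : ∀ q ∈ (extChartAt 𝓘(ℝ, E) p).source, extChartAt 𝓘(ℝ, E) p q ∈ Ω →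
    ∀ y : TangentSpace 𝓘(ℝ, E) q, y ∈ H q ↔ A (extChartAt 𝓘(ℝ, E) p q) (coordMap p q y) = 0
  mem_K : ∀ q ∈ (extChartAt 𝓘(ℝ, E) p).source, extChartAt 𝓘(ℝ, E) p q ∈ Ω →
    ∀ y : TangentSpace 𝓘(ℝ, E) q, y ∈ K q ↔
      S (extChartAt 𝓘(ℝ, E) p q) (A (extChartAt 𝓘(ℝ, E) p q) (coordMap p q y)) = coordMap p q y

/-- If `Fr x` is the isomorphism given by smooth frames of `H` and `K`, then `A` is the second
component of its inverse and `S` its restriction to the second factor. Smoothness of `A` is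
smoothness of inversion of continuous linear maps at an isomorphism. -/
theorem exists_isAdapted [FiniteDimensional ℝ E] {H K : Distribution E M}
    (hH : IsSmoothSubbundle H) (hK : IsSmoothSubbundle K) (hHK : ∀ p, IsCompl (H p) (K p))
    (p : M) : ∃ (Ω : Set E) (m : ℕ) (A : E → E →L[ℝ] (Fin m → ℝ))
      (S : E → (Fin m → ℝ) →L[ℝ] E), IsAdapted H K p Ω A S := by
  have := FiniteDimensional.complete ℝ E
  obtain ⟨n, X, hXs, hX⟩ := hH p
  obtain ⟨m, Y, hYs, hY⟩ := hK p
  have hev : ∀ᶠ x in 𝓝 (extChartAt 𝓘(ℝ, E) p p), x ∈ (extChartAt 𝓘(ℝ, E) p).target ∧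
      ((∀ i, ContDiffAt ℝ ∞ (coordField p (X i)) x) ∧
        ∀ j, ContDiffAt ℝ ∞ (coordField p (Y j)) x) ∧
      (LinearIndependent ℝ (fun i => X i ((extChartAt 𝓘(ℝ, E) p).symm x)) ∧
        Submodule.span ℝ (range fun i => X i ((extChartAt 𝓘(ℝ, E) p).symm x)) =
          H ((extChartAt 𝓘(ℝ, E) p).symm x)) ∧
      LinearIndependent ℝ (fun j => Y j ((extChartAt 𝓘(ℝ, E) p).symm x)) ∧
        Submodule.span ℝ (range fun j => Y j ((extChartAt 𝓘(ℝ, E) p).symm x)) =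
          K ((extChartAt 𝓘(ℝ, E) p).symm x) := by
    have hc := continuousAt_extChartAt_symm (I := 𝓘(ℝ, E)) p
    rw [ContinuousAt, extChartAt_to_inv] at hc
    refine Filter.Eventually.and (extChartAt_target_mem_nhds p) (.and (.and ?_ ?_)
      ((hc.eventually hX).and (hc.eventually hY)))
    · exact eventually_all.2 fun i => (hXs i).eventually_contDiffAt
    · exact eventually_all.2 fun j => (hYs j).eventually_contDiffAt
  obtain ⟨Ω, hΩ, hΩo, hpΩ⟩ := eventually_nhds_iff.1 hev
  set Fr : E → ((Fin n → ℝ) × (Fin m → ℝ)) →L[ℝ] E := fun x =>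
    frameMap (fun i => coordField p (X i) x) (fun j => coordField p (Y j) x) with hFr
  have hFr_apply : ∀ q ∈ (extChartAt 𝓘(ℝ, E) p).source, ∀ z, Fr (extChartAt 𝓘(ℝ, E) p q) z =
      coordMap p q ((Fintype.linearCombination ℝ (fun i => X i q)).coprod
        (Fintype.linearCombination ℝ (fun j => Y j q)) z) := by
    intro q hq z
    simp only [hFr, frameMap_apply, LinearMap.coprod_apply, Fintype.linearCombination_apply,
      coordField_extChartAt hq, map_add, map_sum, map_smul]
  have hcoord : ∀ q ∈ (extChartAt 𝓘(ℝ, E) p).source,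
      Function.Bijective (coordMap (E := E) p q) := fun q hq =>
    ⟨coordMap_injective hq, Function.RightInverse.surjective (coordMap_coordInv hq)⟩
  have key : ∀ q ∈ (extChartAt 𝓘(ℝ, E) p).source, extChartAt 𝓘(ℝ, E) p q ∈ Ω →
      Function.Bijective (Fr (extChartAt 𝓘(ℝ, E) p q)) ∧
      (∀ y : TangentSpace 𝓘(ℝ, E) q, ∀ z, Fr (extChartAt 𝓘(ℝ, E) p q) z = coordMap p q y →
        (y ∈ H q ↔ z.2 = 0) ∧ (y ∈ K q ↔ z.1 = 0)) := by
    intro q hq hqΩ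
    obtain ⟨-, -, ⟨hX1, hX2⟩, hY1, hY2⟩ := hΩ _ hqΩ
    rw [(extChartAt 𝓘(ℝ, E) p).left_inv hq] at hX1 hX2 hY1 hY2
    obtain ⟨hb, hbH, hbK⟩ := bijective_coprod_linearCombination (hHK q) hX1 hY1 hX2 hY2
    refine ⟨?_, fun y z hz => ?_⟩
    · have : ⇑(Fr (extChartAt 𝓘(ℝ, E) p q)) = coordMap p q ∘
        ((Fintype.linearCombination ℝ (fun i => X i q)).coprod
        (Fintype.linearCombination ℝ (fun j => Y j q))) := funext (hFr_apply q hq)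
      rw [this]
      exact (hcoord q hq).comp hb
    · rw [hFr_apply q hq] at hz
      rw [← (hcoord q hq).1 hz]
      exact ⟨hbH z, hbK z⟩
  have hbij : ∀ x ∈ Ω, Function.Bijective (Fr x) := by
    intro x hx
    have hxt := (hΩ x hx).1
    have := (key _ ((extChartAt 𝓘(ℝ, E) p).map_target hxt) (by
      rwa [(extChartAt 𝓘(ℝ, E) p).right_inv hxt])).1
    rwa [(extChartAt 𝓘(ℝ, E) p).right_inv hxt] at this
  have hequiv : ∀ x ∈ Ω, ∃ e : ((Fin n → ℝ) × (Fin m → ℝ)) ≃L[ℝ] E,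
      (e : ((Fin n → ℝ) × (Fin m → ℝ)) →L[ℝ] E) = Fr x := fun x hx =>
    ⟨(LinearEquiv.ofBijective (Fr x : ((Fin n → ℝ) × (Fin m → ℝ)) →ₗ[ℝ] E)
      (hbij x hx)).toContinuousLinearEquiv, rfl⟩
  have hinv : ∀ x ∈ Ω, (∀ z, (Fr x).inverse (Fr x z) = z) ∧ ∀ y, Fr x ((Fr x).inverse y) = y := by
    intro x hx
    obtain ⟨e, he⟩ := hequiv x hx
    rw [← he, ContinuousLinearMap.inverse_equiv]
    exact ⟨e.symm_apply_apply, e.apply_symm_apply⟩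
  have hsm : ∀ x ∈ Ω, ContDiffAt ℝ ∞ Fr x := fun x hx =>
    contDiffAt_frameMap (hΩ x hx).2.1.1 (hΩ x hx).2.1.2
  have hsm' : ∀ x ∈ Ω, ContDiffAt ℝ ∞ (fun x => (Fr x).inverse) x := by
    intro x hx
    obtain ⟨e, he⟩ := hequiv x hx
    refine ContDiffAt.comp x (g := ContinuousLinearMap.inverse) ?_ (hsm x hx)
    rw [← he]
    exact contDiffAt_map_inverse e
  refine ⟨Ω, m, fun x => (ContinuousLinearMap.snd ℝ _ _).comp (Fr x).inverse,
    fun x => (Fr x).comp (ContinuousLinearMap.inr ℝ _ _), hΩo, fun x hx => (hΩ x hx).1, hpΩ,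
    fun x hx => (contDiffAt_const.clm_comp (hsm' x hx)).contDiffWithinAt,
    fun x hx => ((hsm x hx).clm_comp contDiffAt_const).contDiffWithinAt, ?_, ?_, ?_⟩
  · intro x hx w
    simp [(hinv x hx).1]
  · intro q hq hqΩ y
    obtain ⟨z, hz⟩ := (key q hq hqΩ).1.2 (coordMap p q y)
    rw [((key q hq hqΩ).2 y z hz).1, ← hz, ContinuousLinearMap.comp_apply, (hinv _ hqΩ).1]
    rfl
  · intro q hq hqΩ y
    obtain ⟨z, hz⟩ := (key q hq hqΩ).1.2 (coordMap p q y)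
    rw [((key q hq hqΩ).2 y z hz).2, ← hz]
    simp only [ContinuousLinearMap.comp_apply, (hinv _ hqΩ).1, (hbij _ hqΩ).1.eq_iff]
    simp [Prod.ext_iff, eq_comm]

variable {H K K' : Distribution E M} {p : M} {Ω Ω' : Set E} {m m' : ℕ}
  {A : E → E →L[ℝ] (Fin m → ℝ)} {S : E → (Fin m → ℝ) →L[ℝ] E}
  {A' : E → E →L[ℝ] (Fin m' → ℝ)} {S' : E → (Fin m' → ℝ) →L[ℝ] E}

lemma IsAdapted.exists_mem (h : IsAdapted H K p Ω A S) {x : E} (hx : x ∈ Ω) :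
    ∃ q ∈ (extChartAt 𝓘(ℝ, E) p).source, extChartAt 𝓘(ℝ, E) p q = x :=
  ⟨_, (extChartAt 𝓘(ℝ, E) p).map_target (h.subset_target hx),
    (extChartAt 𝓘(ℝ, E) p).right_inv (h.subset_target hx)⟩

/-- For two complements of `H`, the same surjections `A` can be used. -/
theorem IsAdapted.change (h : IsAdapted H K p Ω A S) (h' : IsAdapted H K' p Ω' A' S') :
    IsAdapted H K' p (Ω ∩ Ω') A (fun x => (S' x).comp ((A' x).comp (S x))) := by
  -- Both `A` and `A'` have kernel `H`, whence `A' S A = A'`. So `S' A' S` is a right inverse of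
  -- `A`, and it selects the same complement as `S'`.
  have hker : ∀ x ∈ Ω ∩ Ω', ∀ y, A x y = 0 ↔ A' x y = 0 := by
    intro x hx y
    obtain ⟨q, hq, rfl⟩ := h.exists_mem hx.1
    have h1 := h.mem_H q hq hx.1 (coordInv p q y)
    have h2 := h'.mem_H q hq hx.2 (coordInv p q y)
    rw [coordMap_coordInv hq] at h1 h2
    exact h1.symm.trans h2
  have hAS : ∀ x ∈ Ω ∩ Ω', ∀ y, A' x (S x (A x y)) = A' x y := by
    intro x hx y
    rw [← sub_eq_zero, ← map_sub, ← hker x hx, map_sub, h.A_S x hx.1, sub_self]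
  refine ⟨h.isOpen.inter h'.isOpen, inter_subset_left.trans h.subset_target, ⟨h.mem, h'.mem⟩,
    h.contDiffOn_A.mono inter_subset_left, ?_, ?_, fun q hq hx => h.mem_H q hq hx.1, ?_⟩
  · exact (h'.contDiffOn_S.mono inter_subset_right).clm_comp
      ((h'.contDiffOn_A.mono inter_subset_right).clm_comp
        (h.contDiffOn_S.mono inter_subset_left))
  · intro x hx w
    have h1 : A x (S' x (A' x (S x w)) - S x w) = 0 := by
      rw [hker x hx, map_sub, h'.A_S x hx.2, sub_self]
    rw [map_sub, h.A_S x hx.1, sub_eq_zero] at h1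
    exact h1
  · intro q hq hx y
    rw [h'.mem_K q hq hx.2]
    simp only [ContinuousLinearMap.comp_apply, hAS _ hx]

end Adapted

/-! ### Tangent vectors to the total space of a subbundle. -/

section TotalSpace

variable {E : Type*} [NormedAddCommGroup E] [NormedSpace ℝ E]
  {M : Type*} [TopologicalSpace M] [ChartedSpace E M] [IsManifold 𝓘(ℝ, E) ∞ M]

lemma doubleTangent_ext {p : M} {W W' : DoubleTangent E M} (h : W.proj = W'.proj)
    (hp : W.proj.proj ∈ (extChartAt 𝓘(ℝ, E) p).source)
    (hd : doubleCoord p W = doubleCoord p W') : W = W' := by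
  obtain ⟨k, a⟩ := W
  obtain ⟨k', a'⟩ := W'
  obtain rfl : k = k' := h
  rw [doubleCoord_injective hp hd]

/-- The tangent bundle of the total space of a subbundle, in coordinates. -/
theorem mem_tangentToTotalSpace_iff {H : Distribution E M} {p : M} {Ω : Set E} (hΩ : IsOpen Ω)
    (hΩt : Ω ⊆ (extChartAt 𝓘(ℝ, E) p).target) {Q : E → E →L[ℝ] E} (hQ : ContDiffOn ℝ ∞ Q Ω)
    (hQQ : ∀ x ∈ Ω, ∀ y, Q x (Q x y) = Q x y)
    (hH : ∀ q ∈ (extChartAt 𝓘(ℝ, E) p).source, extChartAt 𝓘(ℝ, E) p q ∈ Ω →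
      ∀ y : TangentSpace 𝓘(ℝ, E) q, y ∈ H q ↔
        Q (extChartAt 𝓘(ℝ, E) p q) (coordMap p q y) = coordMap p q y)
    {W : DoubleTangent E M} (hW : W.proj.proj ∈ (extChartAt 𝓘(ℝ, E) p).source)
    (hWΩ : extChartAt 𝓘(ℝ, E) p W.proj.proj ∈ Ω) :
    W ∈ tangentToTotalSpace H ↔
      Q (bundleChart p W.proj).1 (bundleChart p W.proj).2 = (bundleChart p W.proj).2 ∧
      fderiv ℝ Q (bundleChart p W.proj).1 (doubleCoord p W).1 (bundleChart p W.proj).2 +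
        Q (bundleChart p W.proj).1 (doubleCoord p W).2 = (doubleCoord p W).2 := by
  have hQd : ∀ x ∈ Ω, HasFDerivAt Q (fderiv ℝ Q x) x := fun x hx =>
    ((hQ.contDiffAt (hΩ.mem_nhds hx)).differentiableAt (by simp)).hasFDerivAt
  constructor
  · rintro ⟨c, hc, hcH, rfl⟩
    have hmd := hc.mdifferentiableAt (by simp)
    have hcont : ContinuousAt (fun s => (c s).proj) 0 :=
      (FiberBundle.continuous_proj E (TangentSpace 𝓘(ℝ, E))).continuousAt.comp hc.continuousAt
    have hd : doubleCoord p (⟨c 0, mfderiv 𝓘(ℝ, ℝ) 𝓘(ℝ, E).tangent c 0 (1 : ℝ)⟩ :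
        DoubleTangent E M) = deriv (fun s => bundleChart p (c s)) 0 := by
      have := doubleCoord_mk_mfderivWithin (J := univ) (t := 0) uniqueDiffWithinAt_univ
        hmd.mdifferentiableWithinAt hW
      rwa [mfderivWithin_univ, derivWithin_univ] at this
    have hz : HasDerivAt (fun s => bundleChart p (c s))
        (deriv (fun s => bundleChart p (c s)) 0) 0 := by
      have h1 : MDifferentiableAt 𝓘(ℝ, ℝ) 𝓘(ℝ, E × E) (fun s => bundleChart p (c s)) 0 :=
        MDifferentiableAt.comp (I' := 𝓘(ℝ, E).tangent) 0 (mdifferentiableAt_bundleChart hW) hmd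
      exact (mdifferentiableAt_iff_differentiableAt.1 h1).hasDerivAt
    rw [hd]
    have hz1 : HasDerivAt (fun s => (bundleChart p (c s)).1) _ 0 :=
      (ContinuousLinearMap.fst ℝ E E).hasFDerivAt.comp_hasDerivAt 0 hz
    have hz2 : HasDerivAt (fun s => (bundleChart p (c s)).2) _ 0 :=
      (ContinuousLinearMap.snd ℝ E E).hasFDerivAt.comp_hasDerivAt 0 hz
    -- For a curve in `H`, the second condition is the derivative of the identity `Q(x) y = y`.
    have hQz := (HasFDerivAt.comp_hasDerivAt (0 : ℝ) (l := Q)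
      (f := fun s => (bundleChart p (c s)).1) (hQd _ hWΩ) hz1).clm_apply hz2
    have heq : ∀ᶠ s in 𝓝 (0 : ℝ), Q (bundleChart p (c s)).1 (bundleChart p (c s)).2 =
        (bundleChart p (c s)).2 := by
      have h1 : ∀ᶠ s in 𝓝 (0 : ℝ), (c s).proj ∈ (extChartAt 𝓘(ℝ, E) p).source :=
        hcont.eventually ((isOpen_extChartAt_source p).mem_nhds hW)
      have h2 : ∀ᶠ s in 𝓝 (0 : ℝ), extChartAt 𝓘(ℝ, E) p (c s).proj ∈ Ω :=
        hz1.continuousAt.eventually (hΩ.mem_nhds hWΩ)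
      filter_upwards [hcH, h1, h2] with s hs hs1 hs2
      exact (hH _ hs1 hs2 _).1 hs
    exact ⟨heq.self_of_nhds, hQz.unique (hz2.congr_of_eventuallyEq heq)⟩
  · set x := (bundleChart p W.proj).1
    set y := (bundleChart p W.proj).2
    set u := (doubleCoord p W).1
    set v := (doubleCoord p W).2
    rintro ⟨h1, h2⟩
    have hx : x ∈ Ω := hWΩ
    -- Projecting the straight line through `(x, y)` by `Q` gives a curve in `H` because `Q` is
    -- idempotent; the hypothesis `h2` says exactly that its velocity is still `(u, v)`.
    set z : ℝ → E × E := fun s => (x + s • u, Q (x + s • u) (y + s • v)) with hz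
    have hlin : ∀ a b : E, ContDiff ℝ ∞ (fun s : ℝ => a + s • b) := fun a b =>
      contDiff_const.add (contDiff_id.smul contDiff_const)
    have hlin' : ∀ a b : E, HasDerivAt (fun s : ℝ => a + s • b) b 0 := fun a b => by
      simpa using ((hasDerivAt_id (0 : ℝ)).smul_const b).const_add a
    have hx0 : x + (0 : ℝ) • u = x := by simp
    have hQx : ContDiffAt ℝ ∞ Q (x + (0 : ℝ) • u) := by
      rw [hx0]; exact hQ.contDiffAt (hΩ.mem_nhds hx)
    have hzs : ContDiffAt ℝ ∞ z 0 := (hlin x u).contDiffAt.prodMk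
      ((ContDiffAt.comp (0 : ℝ) (g := Q) (f := fun s : ℝ => x + s • u) hQx
        (hlin x u).contDiffAt).clm_apply (hlin y v).contDiffAt)
    have hz0 : z 0 = bundleChart p W.proj := by
      simp only [hz, zero_smul, add_zero, h1]
      rfl
    have hzd : HasDerivAt z (u, v) 0 := by
      have h3 : HasDerivAt (fun s : ℝ => Q (x + s • u)) (fderiv ℝ Q x u) 0 :=
        HasFDerivAt.comp_hasDerivAt (0 : ℝ) (l := Q) (f := fun s : ℝ => x + s • u)
          (by rw [hx0]; exact hQd x hx) (hlin' x u)
      have h4 := (hlin' x u).prodMk (h3.clm_apply (hlin' y v))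
      simp only [zero_smul, add_zero, h2] at h4
      exact h4
    have hΩ0 : ∀ᶠ s in 𝓝 (0 : ℝ), x + s • u ∈ Ω :=
      (hlin x u).continuous.continuousAt.eventually (by
        simpa using! hΩ.mem_nhds hx)
    have hz0t : (z 0).1 ∈ (extChartAt 𝓘(ℝ, E) p).target := by
      rw [hz0]; exact hΩt hx
    have hcs : ContMDiffAt 𝓘(ℝ, ℝ) 𝓘(ℝ, E).tangent ∞ (fun s => bundleChartSymm p (z s)) 0 :=
      ContMDiffAt.comp (I' := 𝓘(ℝ, E × E)) 0 (contMDiffAt_bundleChartSymm hz0t) hzs.contMDiffAt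
    have hc0 : bundleChartSymm p (z 0) = W.proj := by
      rw [hz0, bundleChartSymm_bundleChart hW]
    refine ⟨fun s => bundleChartSymm p (z s), hcs, ?_, ?_⟩
    · filter_upwards [hΩ0] with s hs
      have hst := hΩt hs
      have h5 := bundleChart_bundleChartSymm (M := M) (p := p) (z := z s) hst
      have h6 := (hH (bundleChartSymm p (z s)).proj ((extChartAt 𝓘(ℝ, E) p).map_target hst)
        (by
          have : extChartAt 𝓘(ℝ, E) p (bundleChartSymm p (z s)).proj = (z s).1 :=
            congrArg Prod.fst h5
          rw [this]; exact hs) (bundleChartSymm p (z s)).snd).2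
      refine h6 ?_
      have h7 : extChartAt 𝓘(ℝ, E) p (bundleChartSymm p (z s)).proj = (z s).1 :=
        congrArg Prod.fst h5
      have h8 : coordMap p (bundleChartSymm p (z s)).proj (bundleChartSymm p (z s)).snd =
        (z s).2 := congrArg Prod.snd h5
      rw [h7, h8]
      exact hQQ _ hs _
    · refine doubleTangent_ext (p := p) hc0.symm hW ?_
      have h5 := doubleCoord_mk_mfderivWithin (p := p) (J := univ) (t := 0)
        uniqueDiffWithinAt_univ (hcs.mdifferentiableAt (by simp)).mdifferentiableWithinAt
        (by rw [hc0]; exact hW)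
      rw [mfderivWithin_univ, derivWithin_univ] at h5
      rw [h5]
      have h6 : (fun s => bundleChart p (bundleChartSymm p (z s))) =ᶠ[𝓝 (0 : ℝ)] z := by
        filter_upwards [hΩ0] with s hs
        exact bundleChart_bundleChartSymm (hΩt hs)
      rw [h6.deriv_eq, hzd.deriv]

end TotalSpace

lemma uniqueDiffOn_of_ordConnected {J : Set ℝ} (hJ : J.OrdConnected) (hJ' : J.Nontrivial) :
    UniqueDiffOn ℝ J := by
  obtain ⟨a, ha, b, hb, hab⟩ := hJ'.exists_lt
  refine uniqueDiffOn_convex hJ.convex ⟨(a + b) / 2, ?_⟩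
  exact interior_maximal (Ioo_subset_Icc_self.trans (hJ.out ha hb)) isOpen_Ioo
    ⟨by linarith, by linarith⟩

/-! ### Parallel sections as solutions of a linear equation. -/

section ParallelODE

variable {E : Type*} [NormedAddCommGroup E] [NormedSpace ℝ E]
  {M : Type*} [TopologicalSpace M] [ChartedSpace E M] [IsManifold 𝓘(ℝ, E) ∞ M]
  {H K : Distribution E M} {p : M} {Ω : Set E} {m : ℕ}
  {A : E → E →L[ℝ] (Fin m → ℝ)} {S : E → (Fin m → ℝ) →L[ℝ] E}

namespace IsAdapted

lemma hasFDerivAt_A (h : IsAdapted H K p Ω A S) {x : E} (hx : x ∈ Ω) :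
    HasFDerivAt A (fderiv ℝ A x) x :=
  ((h.contDiffOn_A.contDiffAt (h.isOpen.mem_nhds hx)).differentiableAt (by simp)).hasFDerivAt

lemma hasFDerivAt_S (h : IsAdapted H K p Ω A S) {x : E} (hx : x ∈ Ω) :
    HasFDerivAt S (fderiv ℝ S x) x :=
  ((h.contDiffOn_S.contDiffAt (h.isOpen.mem_nhds hx)).differentiableAt (by simp)).hasFDerivAt

lemma S_injective (h : IsAdapted H K p Ω A S) {x : E} (hx : x ∈ Ω) :
    Function.Injective (S x) :=
  Function.LeftInverse.injective (h.A_S x hx)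

/-- The projection used is `S A`, whose range is `K`. -/
theorem mem_tangentToTotalSpace_right (h : IsAdapted H K p Ω A S) {W : DoubleTangent E M}
    (hW : W.proj.proj ∈ (extChartAt 𝓘(ℝ, E) p).source)
    (hWΩ : extChartAt 𝓘(ℝ, E) p W.proj.proj ∈ Ω) :
    W ∈ tangentToTotalSpace K ↔
      S (bundleChart p W.proj).1 (A (bundleChart p W.proj).1 (bundleChart p W.proj).2) =
        (bundleChart p W.proj).2 ∧
      fderiv ℝ S (bundleChart p W.proj).1 (doubleCoord p W).1
          (A (bundleChart p W.proj).1 (bundleChart p W.proj).2) +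
        S (bundleChart p W.proj).1
          (fderiv ℝ A (bundleChart p W.proj).1 (doubleCoord p W).1 (bundleChart p W.proj).2 +
            A (bundleChart p W.proj).1 (doubleCoord p W).2) = (doubleCoord p W).2 := by
  have hx : (bundleChart p W.proj).1 ∈ Ω := hWΩ
  rw [mem_tangentToTotalSpace_iff (Q := fun x => (S x).comp (A x)) h.isOpen h.subset_target
    (h.contDiffOn_S.clm_comp h.contDiffOn_A)
    (fun x hx y => by simp [h.A_S x hx]) (fun q hq hqΩ y => h.mem_K q hq hqΩ y) hW hWΩ,
    ((h.hasFDerivAt_S hx).clm_comp (h.hasFDerivAt_A hx)).fderiv]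
  simp [add_comm, add_left_comm]

/-- The projection used is `1 - S A`, whose range is `H`. Once `A y = 0`, the derivative of `S`
drops out, and injectivity of `S` leaves the linearization of the equation `A y = 0`. -/
theorem mem_tangentToTotalSpace_left (h : IsAdapted H K p Ω A S) {W : DoubleTangent E M}
    (hW : W.proj.proj ∈ (extChartAt 𝓘(ℝ, E) p).source)
    (hWΩ : extChartAt 𝓘(ℝ, E) p W.proj.proj ∈ Ω) :
    W ∈ tangentToTotalSpace H ↔
      A (bundleChart p W.proj).1 (bundleChart p W.proj).2 = 0 ∧
      fderiv ℝ A (bundleChart p W.proj).1 (doubleCoord p W).1 (bundleChart p W.proj).2 +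
        A (bundleChart p W.proj).1 (doubleCoord p W).2 = 0 := by
  have hx : (bundleChart p W.proj).1 ∈ Ω := hWΩ
  have hS0 : ∀ x ∈ Ω, ∀ w, S x w = 0 ↔ w = 0 := fun x hx w => by
    rw [← (h.S_injective hx).eq_iff (a := w), map_zero]
  rw [mem_tangentToTotalSpace_iff
    (Q := fun x => ContinuousLinearMap.id ℝ E - (S x).comp (A x)) h.isOpen h.subset_target
    (contDiffOn_const.sub (h.contDiffOn_S.clm_comp h.contDiffOn_A))
    (fun x hx y => by simp [h.A_S x hx])
    (fun q hq hqΩ y => by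
      rw [h.mem_H q hq hqΩ y, ← hS0 _ hqΩ, sub_apply,
        ContinuousLinearMap.id_apply, ContinuousLinearMap.comp_apply, sub_eq_self]) hW hWΩ,
    (((h.hasFDerivAt_S hx).clm_comp (h.hasFDerivAt_A hx)).const_sub
      (ContinuousLinearMap.id ℝ E)).fderiv]
  simp only [sub_apply, ContinuousLinearMap.id_apply,
    ContinuousLinearMap.comp_apply, sub_eq_self, hS0 _ hx]
  refine and_congr_right fun h0 => ?_
  rw [← hS0 _ hx, map_add]
  simp only [neg_apply, add_apply,
    ContinuousLinearMap.compL_apply, ContinuousLinearMap.comp_apply,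
    ContinuousLinearMap.flip_apply, h0, map_zero, add_zero]
  constructor
  · intro h1
    have h2 := congrArg (fun z => -(z - (doubleCoord p W).2)) h1
    simp only [sub_self, neg_zero] at h2
    rw [← h2]
    abel
  · intro h1
    rw [← sub_eq_zero, ← neg_eq_zero, ← h1]
    abel

end IsAdapted

/-- The endomorphism describing, in coordinates, parallel transport in the direction `u`. -/
def connectionMap (A : E → E →L[ℝ] (Fin m → ℝ)) (S : E → (Fin m → ℝ) →L[ℝ] E) (x u : E) :
    (Fin m → ℝ) →L[ℝ] (Fin m → ℝ) :=
  (fderiv ℝ A x u - (fderiv ℝ A x).flip u).comp (S x)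

lemma connectionMap_apply (x u : E) (w : Fin m → ℝ) :
    connectionMap A S x u w = fderiv ℝ A x u (S x w) - fderiv ℝ A x (S x w) u := rfl

/-- The condition of `IsParallel` at a single time. -/
def IsParallelAt (H K : Distribution E M) (β : ℝ → M) (J : Set ℝ)
    (σ : (t : ℝ) → TangentSpace 𝓘(ℝ, E) (β t)) (t : ℝ) : Prop :=
  σ t ∈ K (β t) ∧
  MDifferentiableWithinAt 𝓘(ℝ, ℝ) 𝓘(ℝ, E).tangent
    (fun t => (⟨β t, σ t⟩ : TangentBundle 𝓘(ℝ, E) M)) J t ∧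
  (⟨⟨β t, σ t⟩, mfderivWithin 𝓘(ℝ, ℝ) 𝓘(ℝ, E).tangent
      (fun r => (⟨β r, σ r⟩ : TangentBundle 𝓘(ℝ, E) M)) J t (1 : ℝ)⟩ : DoubleTangent E M) ∈
    tangentToTotalSpace K ∩ canonicalFlip '' tangentToTotalSpace H

lemma isParallel_iff {β : ℝ → M} {J : Set ℝ} {σ : (t : ℝ) → TangentSpace 𝓘(ℝ, E) (β t)} :
    IsParallel H K β J σ ↔ ∀ t ∈ J, IsParallelAt H K β J σ t :=
  ⟨fun h t ht => ⟨h.1 t ht, h.2.1 t ht, h.2.2 t ht⟩,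
    fun h => ⟨fun t ht => (h t ht).1, fun t ht => (h t ht).2.1, fun t ht => (h t ht).2.2⟩⟩

/-- A path of `TM` is differentiable if its coordinates are. -/
lemma mdifferentiableWithinAt_section_iff {β : ℝ → M} {J : Set ℝ} {t : ℝ}
    {σ : (t : ℝ) → TangentSpace 𝓘(ℝ, E) (β t)}
    (hβ : MDifferentiableWithinAt 𝓘(ℝ, ℝ) 𝓘(ℝ, E) β J t)
    (hp : β t ∈ (extChartAt 𝓘(ℝ, E) p).source) :
    MDifferentiableWithinAt 𝓘(ℝ, ℝ) 𝓘(ℝ, E).tangent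
      (fun t => (⟨β t, σ t⟩ : TangentBundle 𝓘(ℝ, E) M)) J t ↔
    DifferentiableWithinAt ℝ (fun r => coordMap p (β r) (σ r)) J t := by
  have hp' := hp
  rw [extChartAt_source] at hp'
  have hb : DifferentiableWithinAt ℝ (fun r => extChartAt 𝓘(ℝ, E) p (β r)) J t :=
    mdifferentiableWithinAt_iff_differentiableWithinAt.1
      (MDifferentiableAt.comp_mdifferentiableWithinAt (I' := 𝓘(ℝ, E)) t
        (mdifferentiableAt_extChartAt hp') hβ)
  constructor
  · intro h
    have h1 : MDifferentiableWithinAt 𝓘(ℝ, ℝ) 𝓘(ℝ, E × E)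
        (fun r => bundleChart p (⟨β r, σ r⟩ : TangentBundle 𝓘(ℝ, E) M)) J t :=
      MDifferentiableAt.comp_mdifferentiableWithinAt (I' := 𝓘(ℝ, E).tangent) t
        (mdifferentiableAt_bundleChart hp) h
    exact (mdifferentiableWithinAt_iff_differentiableWithinAt.1 h1).snd
  · intro h
    have h1 : MDifferentiableWithinAt 𝓘(ℝ, ℝ) 𝓘(ℝ, E).tangent
        (fun r => bundleChartSymm p (extChartAt 𝓘(ℝ, E) p (β r), coordMap p (β r) (σ r))) J t :=
      MDifferentiableAt.comp_mdifferentiableWithinAt (I' := 𝓘(ℝ, E × E)) t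
        (mdifferentiableAt_bundleChartSymm ((extChartAt 𝓘(ℝ, E) p).map_source hp))
        (mdifferentiableWithinAt_iff_differentiableWithinAt.2 (hb.prodMk h))
    refine h1.congr_of_eventuallyEq ?_ (bundleChartSymm_bundleChart hp).symm
    filter_upwards [hβ.continuousWithinAt.eventually
      ((isOpen_extChartAt_source (I := 𝓘(ℝ, E)) p).mem_nhds hp)] with r hr
    exact (bundleChartSymm_bundleChart (k := (⟨β r, σ r⟩ : TangentBundle 𝓘(ℝ, E) M)) hr).symm

/-- In coordinates, parallel sections are the solutions of a linear differential equation. -/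
theorem IsAdapted.isParallelAt_iff (h : IsAdapted H K p Ω A S) {β : ℝ → M} {J : Set ℝ} {t : ℝ}
    (ht : t ∈ J) (hJ : UniqueDiffWithinAt ℝ J t)
    (hβ : MDifferentiableWithinAt 𝓘(ℝ, ℝ) 𝓘(ℝ, E) β J t)
    (hβH : velocity (E := E) β J t ∈ H (β t)) (hp : β t ∈ (extChartAt 𝓘(ℝ, E) p).source)
    (hpΩ : extChartAt 𝓘(ℝ, E) p (β t) ∈ Ω) {σ : (t : ℝ) → TangentSpace 𝓘(ℝ, E) (β t)}
    (hσ : ∀ᶠ r in 𝓝[J] t, σ r ∈ K (β r)) :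
    IsParallelAt H K β J σ t ↔
      HasDerivWithinAt (fun r => A (extChartAt 𝓘(ℝ, E) p (β r)) (coordMap p (β r) (σ r)))
        (connectionMap A S (extChartAt 𝓘(ℝ, E) p (β t))
          (derivWithin (fun r => extChartAt 𝓘(ℝ, E) p (β r)) J t)
          (A (extChartAt 𝓘(ℝ, E) p (β t)) (coordMap p (β t) (σ t)))) J t := by
  have hp' := hp
  rw [extChartAt_source] at hp'
  set b : ℝ → E := fun r => extChartAt 𝓘(ℝ, E) p (β r) with hbdef
  set y : ℝ → E := fun r => coordMap p (β r) (σ r) with hydef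
  have hb : HasDerivWithinAt b (derivWithin b J t) J t :=
    (mdifferentiableWithinAt_iff_differentiableWithinAt.1
      (MDifferentiableAt.comp_mdifferentiableWithinAt (I' := 𝓘(ℝ, E)) t
        (mdifferentiableAt_extChartAt hp') hβ)).hasDerivWithinAt
  set b' := derivWithin b J t with hb'def
  have hbt : b t ∈ Ω := hpΩ
  have hAb' : A (b t) b' = 0 := by
    have h1 := (h.mem_H _ hp hpΩ _).1 hβH
    rwa [coordMap_mfderivWithin hJ hβ hp] at h1
  have hAd : HasDerivWithinAt (fun r => A (b r)) (fderiv ℝ A (b t) b') J t :=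
    HasFDerivAt.comp_hasDerivWithinAt (l := A) (f := b) t (h.hasFDerivAt_A hbt) hb
  have hSd : HasDerivWithinAt (fun r => S (b r)) (fderiv ℝ S (b t) b') J t :=
    HasFDerivAt.comp_hasDerivWithinAt (l := S) (f := b) t (h.hasFDerivAt_S hbt) hb
  have hSA : ∀ᶠ r in 𝓝[J] t, S (b r) (A (b r) (y r)) = y r := by
    filter_upwards [hσ, hβ.continuousWithinAt.eventually
      ((isOpen_extChartAt_source (I := 𝓘(ℝ, E)) p).mem_nhds hp),
      hb.continuousWithinAt.eventually (h.isOpen.mem_nhds hbt)] with r h1 h2 h3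
    exact (h.mem_K _ h2 h3 _).1 h1
  have hσt : σ t ∈ K (β t) := hσ.self_of_nhdsWithin ht
  have hSAt : S (b t) (A (b t) (y t)) = y t := hSA.self_of_nhdsWithin ht
  rw [IsParallelAt, mdifferentiableWithinAt_section_iff hβ hp]
  -- Tangency to `K` is automatic, by differentiating `S A y = y`. Of the two conditions for the
  -- flipped vector, `A b' = 0` holds because the path is tangent to `H`; only one equation remains.
  have key : ∀ y' : E, HasDerivWithinAt y y' J t →
      ((⟨⟨β t, σ t⟩, mfderivWithin 𝓘(ℝ, ℝ) 𝓘(ℝ, E).tangent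
        (fun r => (⟨β r, σ r⟩ : TangentBundle 𝓘(ℝ, E) M)) J t (1 : ℝ)⟩ : DoubleTangent E M) ∈
        tangentToTotalSpace K ∩ canonicalFlip '' tangentToTotalSpace H ↔
      fderiv ℝ A (b t) (y t) b' + A (b t) y' = 0) := by
    intro y' hy
    set W : DoubleTangent E M := ⟨⟨β t, σ t⟩, mfderivWithin 𝓘(ℝ, ℝ) 𝓘(ℝ, E).tangent
        (fun r => (⟨β r, σ r⟩ : TangentBundle 𝓘(ℝ, E) M)) J t (1 : ℝ)⟩ with hWdef
    have hWp : bundleChart p W.proj = (b t, y t) := rfl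
    have hWd : doubleCoord p W = (b', y') := by
      have h1 := doubleCoord_mk_mfderivWithin (p := p) hJ
        ((mdifferentiableWithinAt_section_iff hβ hp).2 hy.differentiableWithinAt) hp
      exact h1.trans ((hb.prodMk hy).derivWithin hJ)
    have hflip := doubleCoord_canonicalFlip (W := W) hp
    rw [hWp, hWd] at hflip
    rw [mem_inter_iff, mem_image_canonicalFlip, h.mem_tangentToTotalSpace_right (W := W) hp hpΩ,
      h.mem_tangentToTotalSpace_left (W := canonicalFlip W) hp hpΩ, hflip.1, hflip.2, hWp, hWd]
    have hK : fderiv ℝ S (b t) b' (A (b t) (y t)) +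
        S (b t) (fderiv ℝ A (b t) b' (y t) + A (b t) y') = y' :=
      hJ.eq_deriv _ (hSd.clm_apply (hAd.clm_apply hy))
        (hy.congr_of_eventuallyEq hSA hSAt)
    simp only [hSAt, hK, hAb', true_and]
  constructor
  · rintro ⟨-, hd, hmem⟩
    have hy := hd.hasDerivWithinAt
    have h0 := (key _ hy).1 hmem
    convert! hAd.clm_apply hy using 1
    rw [connectionMap_apply, hSAt, eq_neg_of_add_eq_zero_right h0, sub_eq_add_neg]
  · intro hw
    -- Differentiability of the section is recovered from that of `w = A y` through `y = S w`.
    obtain ⟨y', hy⟩ : ∃ y', HasDerivWithinAt y y' J t :=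
      ⟨_, (hSd.clm_apply hw).congr_of_eventuallyEq (hSA.mono fun r hr => hr.symm) hSAt.symm⟩
    refine ⟨hσt, hy.differentiableWithinAt, (key _ hy).2 ?_⟩
    have h1 : connectionMap A S (b t) b' (A (b t) (y t)) =
      fderiv ℝ A (b t) b' (y t) + A (b t) y' := hJ.eq_deriv _ hw (hAd.clm_apply hy)
    rw [connectionMap_apply, hSAt, sub_eq_add_neg] at h1
    rw [← add_left_cancel h1, add_neg_cancel]

end ParallelODE

/-! ### Existence and uniqueness of parallel transport. -/

section FlatTransport

variable {E : Type*} [NormedAddCommGroup E] [NormedSpace ℝ E]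
  {M : Type*} [TopologicalSpace M] [ChartedSpace E M] [IsManifold 𝓘(ℝ, E) ∞ M]
  {H K : Distribution E M} {p : M} {Ω : Set E} {m : ℕ}
  {A : E → E →L[ℝ] (Fin m → ℝ)} {S : E → (Fin m → ℝ) →L[ℝ] E}
  {β : ℝ → M} {J : Set ℝ}

/-- Fundamental solutions of the equation of parallel transport near a given time. -/
theorem IsAdapted.exists_fundamental_solution {c : ℝ} (h : IsAdapted H K (β c) Ω A S)
    (hJ : J.OrdConnected) (hJ' : J.Nontrivial) (hβ : ContMDiffOn 𝓘(ℝ, ℝ) 𝓘(ℝ, E) ∞ β J)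
    (hc : c ∈ J) :
    ∃ ε > 0, ∃ Φ Ψ : ℝ → (Fin m → ℝ) →L[ℝ] (Fin m → ℝ), Ψ c = 1 ∧
      ∀ t ∈ J ∩ Ioo (c - ε) (c + ε),
        (β t ∈ (extChartAt 𝓘(ℝ, E) (β c)).source ∧ extChartAt 𝓘(ℝ, E) (β c) (β t) ∈ Ω) ∧
        HasDerivWithinAt Φ (connectionMap A S (extChartAt 𝓘(ℝ, E) (β c) (β t))
          (derivWithin (fun r => extChartAt 𝓘(ℝ, E) (β c) (β r)) J t) * Φ t) J t ∧
        HasDerivWithinAt Ψ (-(Ψ t * connectionMap A S (extChartAt 𝓘(ℝ, E) (β c) (β t))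
          (derivWithin (fun r => extChartAt 𝓘(ℝ, E) (β c) (β r)) J t))) J t ∧
        Ψ t * Φ t = 1 ∧ Φ t * Ψ t = 1 := by
  set b : ℝ → E := fun r => extChartAt 𝓘(ℝ, E) (β c) (β r) with hbdef
  have hJu := uniqueDiffOn_of_ordConnected hJ hJ'
  have hev : ∀ᶠ r in 𝓝[J] c, β r ∈ (extChartAt 𝓘(ℝ, E) (β c)).source ∧ b r ∈ Ω := by
    have h1 := (hβ c hc).continuousWithinAt
    refine (h1.eventually (extChartAt_source_mem_nhds (β c))).and ?_
    exact (ContinuousAt.comp_continuousWithinAt (continuousAt_extChartAt (β c)) h1).eventually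
      (h.isOpen.mem_nhds h.mem)
  obtain ⟨N, hNo, hcN, hN⟩ := mem_nhdsWithin.1 hev
  have hN' : ∀ r ∈ J ∩ N, β r ∈ (extChartAt 𝓘(ℝ, E) (β c)).source ∧ b r ∈ Ω :=
    fun r hr => hN hr.symm
  have hbs : ContDiffOn ℝ ∞ b (J ∩ N) := by
    rw [← contMDiffOn_iff_contDiffOn]
    intro r hr
    have h1 := (hN' r hr).1
    rw [extChartAt_source] at h1
    exact ContMDiffAt.comp_contMDiffWithinAt (I' := 𝓘(ℝ, E)) r (contMDiffAt_extChartAt' h1)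
      ((hβ r hr.1).mono inter_subset_left)
  have hb'c : ContinuousOn (derivWithin b J) (J ∩ N) := by
    refine (hbs.continuousOn_derivWithin (hJu.inter hNo) (by simp)).congr fun r hr => ?_
    exact (derivWithin_inter (hNo.mem_nhds hr.2)).symm
  have hmaps : MapsTo b (J ∩ N) Ω := fun r hr => (hN' r hr).2
  have hdA : ContinuousOn (fun r => fderiv ℝ A (b r)) (J ∩ N) :=
    (h.contDiffOn_A.continuousOn_fderiv_of_isOpen h.isOpen (by simp)).comp hbs.continuousOn hmaps
  have hΘ : ContinuousOn (fun r => connectionMap A S (b r) (derivWithin b J r)) (J ∩ N) := by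
    refine ContinuousOn.clm_comp ((hdA.clm_apply hb'c).sub ?_)
      (h.contDiffOn_S.continuousOn.comp hbs.continuousOn hmaps)
    exact ((ContinuousLinearMap.flipₗᵢ ℝ E E (Fin m → ℝ)).continuous.comp_continuousOn
      hdA).clm_apply hb'c
  obtain ⟨ε, hε, Φ, Ψ, -, hΨ0, hΦ, hΨ, hmul⟩ :=
    TangentSubbundle.exists_fundamental_solution hJ hc (hNo.mem_nhds hcN) _ hΘ
  obtain ⟨δ, hδ, hball⟩ := Metric.isOpen_iff.1 hNo c hcN
  have hle : ∀ t ∈ J ∩ Ioo (c - min ε δ) (c + min ε δ), t ∈ J ∩ Ioo (c - ε) (c + ε) :=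
    fun t ht => ⟨ht.1, by linarith [min_le_left ε δ, ht.2.1],
      by linarith [min_le_left ε δ, ht.2.2]⟩
  refine ⟨min ε δ, lt_min hε hδ, Φ, Ψ, hΨ0, fun t ht => ⟨hN' t ⟨ht.1, hball ?_⟩,
    hΦ t (hle t ht), hΨ t (hle t ht), hmul t (hle t ht)⟩⟩
  rw [Metric.mem_ball, Real.dist_eq, abs_lt]
  constructor <;> linarith [min_le_right ε δ, ht.2.1, ht.2.2]

/-- Along a parallel section, `w' = Γ w` while `Ψ' = -Ψ Γ`, so `Ψ w` has derivative zero. -/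
theorem IsAdapted.fundamental_solution_const {c : ℝ} (h : IsAdapted H K (β c) Ω A S)
    (hJ : J.OrdConnected) (hJ' : J.Nontrivial) (hβ : ContMDiffOn 𝓘(ℝ, ℝ) 𝓘(ℝ, E) ∞ β J)
    (hβH : ∀ t ∈ J, velocity (E := E) β J t ∈ H (β t))
    {Ψ : ℝ → (Fin m → ℝ) →L[ℝ] (Fin m → ℝ)} {U : Set ℝ} (hUo : IsOpen U) (hU : U.OrdConnected)
    (hΨ : ∀ t ∈ J ∩ U,
      (β t ∈ (extChartAt 𝓘(ℝ, E) (β c)).source ∧ extChartAt 𝓘(ℝ, E) (β c) (β t) ∈ Ω) ∧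
      HasDerivWithinAt Ψ (-(Ψ t * connectionMap A S (extChartAt 𝓘(ℝ, E) (β c) (β t))
          (derivWithin (fun r => extChartAt 𝓘(ℝ, E) (β c) (β r)) J t))) J t)
    {σ : (t : ℝ) → TangentSpace 𝓘(ℝ, E) (β t)} (hσ : ∀ t ∈ J ∩ U, IsParallelAt H K β J σ t)
    {s t : ℝ} (hs : s ∈ J ∩ U) (ht : t ∈ J ∩ U) :
    Ψ s (A (extChartAt 𝓘(ℝ, E) (β c) (β s)) (coordMap (β c) (β s) (σ s))) =
      Ψ t (A (extChartAt 𝓘(ℝ, E) (β c) (β t)) (coordMap (β c) (β t) (σ t))) := by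
  have hJu := uniqueDiffOn_of_ordConnected hJ hJ'
  refine eqOn_of_hasDerivWithinAt_zero (hJ.inter hU) (f := fun t => Ψ t (A (extChartAt 𝓘(ℝ, E)
    (β c) (β t)) (coordMap (β c) (β t) (σ t)))) (fun r hr => ?_) hs ht
  obtain ⟨⟨h1, h2⟩, h3⟩ := hΨ r hr
  have hK : ∀ᶠ r' in 𝓝[J] r, σ r' ∈ K (β r') := by
    filter_upwards [mem_nhdsWithin_of_mem_nhds (hUo.mem_nhds hr.2), self_mem_nhdsWithin]
      with r' h4 h5
    exact (hσ r' ⟨h5, h4⟩).1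
  have h4 := (h.isParallelAt_iff hr.1 (hJu r hr.1) ((hβ r hr.1).mdifferentiableWithinAt (by simp))
    (hβH r hr.1) h1 h2 hK).1 (hσ r hr)
  convert! (h3.clm_apply h4).mono inter_subset_left using 1
  simp

/-- The trivialization is `Ψ ∘ A` in coordinates, with inverse `S ∘ Φ`: sections `S Φ w` with
constant `w` are parallel, and `Ψ A` is constant along every parallel section. -/
theorem isFlat_isParallelAt [FiniteDimensional ℝ E] (hH : IsSmoothSubbundle H)
    (hK : IsSmoothSubbundle K) (hHK : ∀ p, IsCompl (H p) (K p))
    (hJ : J.OrdConnected) (hJ' : J.Nontrivial) (hβ : ContMDiffOn 𝓘(ℝ, ℝ) 𝓘(ℝ, E) ∞ β J)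
    (hβH : ∀ t ∈ J, velocity (E := E) β J t ∈ H (β t)) :
    IsFlat J (fun t => K (β t)) (IsParallelAt H K β J) := by
  have hJu := uniqueDiffOn_of_ordConnected hJ hJ'
  refine ⟨fun h => h.1, ?_, ?_⟩
  · rintro σ σ' t ht he ⟨h1, h2, h3⟩
    have het : σ t = σ' t := he.self_of_nhdsWithin ht
    have hes : (fun r => (⟨β r, σ' r⟩ : TangentBundle 𝓘(ℝ, E) M)) =ᶠ[𝓝[J] t]
        fun r => (⟨β r, σ r⟩ : TangentBundle 𝓘(ℝ, E) M) :=
      he.mono fun r hr => by simp only [hr]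
    have hest : (⟨β t, σ' t⟩ : TangentBundle 𝓘(ℝ, E) M) = ⟨β t, σ t⟩ := by rw [het]
    refine ⟨het ▸ h1, h2.congr_of_eventuallyEq hes hest, ?_⟩
    have h4 := hes.mfderivWithin_eq (I := 𝓘(ℝ, ℝ)) (I' := 𝓘(ℝ, E).tangent) hest
    have h5 : (⟨⟨β t, σ' t⟩, mfderivWithin 𝓘(ℝ, ℝ) 𝓘(ℝ, E).tangent
        (fun r => (⟨β r, σ' r⟩ : TangentBundle 𝓘(ℝ, E) M)) J t (1 : ℝ)⟩ : DoubleTangent E M) =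
        ⟨⟨β t, σ t⟩, mfderivWithin 𝓘(ℝ, ℝ) 𝓘(ℝ, E).tangent
        (fun r => (⟨β r, σ r⟩ : TangentBundle 𝓘(ℝ, E) M)) J t (1 : ℝ)⟩ := by
      rw [h4]
      congr 1
    rw [h5]
    exact h3
  · intro c hc
    obtain ⟨Ω, m, A, S, h⟩ := exists_isAdapted hH hK hHK (β c)
    obtain ⟨ε, hε, Φ, Ψ, hΨ0, hΦΨ⟩ := h.exists_fundamental_solution hJ hJ' hβ hc
    refine ⟨ε, hε, m,
      fun r => ((Ψ r).comp ((A (extChartAt 𝓘(ℝ, E) (β c) (β r))).comp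
        (coordMap (β c) (β r)))).toLinearMap,
      fun r => ((coordInv (β c) (β r)).comp
        ((S (extChartAt 𝓘(ℝ, E) (β c) (β r))).comp (Φ r))).toLinearMap, ?_, ?_⟩
    · have hb : ∀ t ∈ J ∩ Ioo (c - ε) (c + ε), ∀ w, coordInv (β c) (β t)
          (S (extChartAt 𝓘(ℝ, E) (β c) (β t)) (Φ t w)) ∈ K (β t) := by
        intro t ht w
        obtain ⟨⟨h1, h2⟩, -⟩ := hΦΨ t ht
        rw [h.mem_K _ h1 h2, coordMap_coordInv h1, h.A_S _ h2]
      intro t ht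
      obtain ⟨⟨h1, h2⟩, h3, -, h4, h5⟩ := hΦΨ t ht
      have h4' : ∀ w, Ψ t (Φ t w) = w := fun w =>
        congrArg (fun T : (Fin m → ℝ) →L[ℝ] (Fin m → ℝ) => T w) h4
      have h5' : ∀ w, Φ t (Ψ t w) = w := fun w =>
        congrArg (fun T : (Fin m → ℝ) →L[ℝ] (Fin m → ℝ) => T w) h5
      refine ⟨hb t ht, fun w => ?_, fun k hk => ?_, fun w => ?_⟩
      · simp only [ContinuousLinearMap.coe_coe, ContinuousLinearMap.comp_apply]
        rw [coordMap_coordInv h1, h.A_S _ h2, h4']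
      · simp only [ContinuousLinearMap.coe_coe, ContinuousLinearMap.comp_apply]
        rw [h5', (h.mem_K _ h1 h2 k).1 hk, coordInv_coordMap h1]
      · have hnear : ∀ᶠ r in 𝓝[J] t, r ∈ J ∩ Ioo (c - ε) (c + ε) :=
          inter_mem_nhdsWithin J (isOpen_Ioo.mem_nhds ht.2)
        refine (h.isParallelAt_iff ht.1 (hJu t ht.1)
          ((hβ t ht.1).mdifferentiableWithinAt (by simp)) (hβH t ht.1) h1 h2
          (hnear.mono fun r hr => hb r hr w)).2 ?_
        have hval : ∀ r ∈ J ∩ Ioo (c - ε) (c + ε), A (extChartAt 𝓘(ℝ, E) (β c) (β r))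
            (coordMap (β c) (β r) (coordInv (β c) (β r)
              (S (extChartAt 𝓘(ℝ, E) (β c) (β r)) (Φ r w)))) = Φ r w := by
          intro r hr
          obtain ⟨⟨h6, h7⟩, -⟩ := hΦΨ r hr
          rw [coordMap_coordInv h6, h.A_S _ h7]
        change HasDerivWithinAt _ (connectionMap A S _ _ (A _ (coordMap (β c) (β t)
          (coordInv (β c) (β t) (S _ (Φ t w)))))) J t
        rw [hval t ht]
        have h6 := h3.clm_apply (hasDerivWithinAt_const t J w)
        refine HasDerivWithinAt.congr_of_eventuallyEq ?_ (hnear.mono hval) (hval t ht)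
        simpa using h6
    · intro σ U hUo hU hUε hσ s hs t ht
      refine h.fundamental_solution_const hJ hJ' hβ hβH hUo hU (fun r hr => ?_) hσ hs ht
      have := hΦΨ r ⟨hr.1, hUε hr.2⟩
      exact ⟨this.1, this.2.2.1⟩

/-- `transport` is obtained by choice; uniqueness of parallel sections makes the chosen map
compatible with any given one. -/
theorem transport_eq [FiniteDimensional ℝ E] (hH : IsSmoothSubbundle H)
    (hK : IsSmoothSubbundle K) (hHK : ∀ p, IsCompl (H p) (K p))
    (hJ : J.OrdConnected) (hJ' : J.Nontrivial) (hβ : ContMDiffOn 𝓘(ℝ, ℝ) 𝓘(ℝ, E) ∞ β J)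
    (hβH : ∀ t ∈ J, velocity (E := E) β J t ∈ H (β t)) {s t : ℝ} (hs : s ∈ J) (ht : t ∈ J)
    {σ : (t : ℝ) → TangentSpace 𝓘(ℝ, E) (β t)} (hσ : ∀ t ∈ J, IsParallelAt H K β J σ t) :
    transport H K β J s t ⟨σ s, (hσ s hs).1⟩ = ⟨σ t, (hσ t ht).1⟩ := by
  have hflat := isFlat_isParallelAt hH hK hHK hJ hJ' hβ hβH
  have hex : ∃ τ, IsTransport H K β J s t τ := by
    obtain ⟨τ, hτ⟩ := hflat.exists_linearMap hJ hs ht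
    refine ⟨τ, fun w => ?_⟩
    obtain ⟨σ, h1, h2, h3⟩ := hτ w
    exact ⟨σ, isParallel_iff.2 h1, h2, h3⟩
  rw [transport, dif_pos hex]
  obtain ⟨σ', h1, h2, h3⟩ := hex.choose_spec ⟨σ s, (hσ s hs).1⟩
  refine Subtype.ext ?_
  rw [← h3]
  exact hflat.eq_of_eq' hJ (isParallel_iff.1 h1) hσ hs ht h2

end FlatTransport

/-! ### The curvature tensor in coordinates. -/

section CurvatureFormula

/-- The alternating map defined by an alternating bilinear map. -/
def alternatingOfBilinear {V W : Type*} [AddCommGroup V] [Module ℝ V] [AddCommGroup W]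
    [Module ℝ W] (B : V →ₗ[ℝ] V →ₗ[ℝ] W) (hB : ∀ v, B v v = 0) : V [⋀^Fin 2]→ₗ[ℝ] W where
  toFun m := B (m 0) (m 1)
  map_update_add' m i x y := by
    fin_cases i <;> simp [Function.update]
  map_update_smul' m i c x := by
    fin_cases i <;> simp [Function.update]
  map_eq_zero_of_eq' m i j h hij := by
    fin_cases i <;> fin_cases j <;> simp_all

lemma alternatingOfBilinear_apply {V W : Type*} [AddCommGroup V] [Module ℝ V] [AddCommGroup W]
    [Module ℝ W] (B : V →ₗ[ℝ] V →ₗ[ℝ] W) (hB : ∀ v, B v v = 0) (u v : V) :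
    alternatingOfBilinear B hB ![u, v] = B u v := rfl

variable {E : Type*} [NormedAddCommGroup E] [NormedSpace ℝ E]
  {M : Type*} [TopologicalSpace M] [ChartedSpace E M] [IsManifold 𝓘(ℝ, E) ∞ M]
  {H K : Distribution E M} {p : M} {Ω : Set E} {m : ℕ}
  {A : E → E →L[ℝ] (Fin m → ℝ)} {S : E → (Fin m → ℝ) →L[ℝ] E}

/-- Take constant coefficients in a local frame. -/
lemma IsSmoothSubbundle.exists_isSectionNear (hH : IsSmoothSubbundle H) (p : M) (u : H p) :
    ∃ X : (q : M) → TangentSpace 𝓘(ℝ, E) q, IsSectionNear H X p ∧ X p = u := by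
  obtain ⟨n, X, hXs, hX⟩ := hH p
  have hu : (u : TangentSpace 𝓘(ℝ, E) p) ∈ LinearMap.range
      (Fintype.linearCombination ℝ (fun i => X i p)) := by
    rw [Fintype.range_linearCombination, hX.self_of_nhds.2]
    exact u.2
  obtain ⟨a, ha⟩ := hu
  refine ⟨fun q => ∑ i, a i • X i q, ⟨?_, ?_⟩, ha⟩
  · have : ∀ᶠ q in 𝓝 p, ∀ i, ContMDiffAt 𝓘(ℝ, E) 𝓘(ℝ, E).tangent ∞
        (fun x : M => (⟨x, X i x⟩ : TangentBundle 𝓘(ℝ, E) M)) q := eventually_all.2 hXs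
    filter_upwards [this] with q hq
    exact ContMDiffAt.sum_section fun i _ => (hq i).const_smul_section
  · filter_upwards [hX] with q hq
    rw [← hq.2]
    exact Submodule.sum_mem _ fun i _ =>
      Submodule.smul_mem _ _ (Submodule.subset_span (mem_range_self i))

lemma mpullbackWithin_extChartAt_symm (p : M) (X : (q : M) → TangentSpace 𝓘(ℝ, E) q) {x : E}
    (hx : x ∈ (extChartAt 𝓘(ℝ, E) p).target) :
    VectorField.mpullbackWithin 𝓘(ℝ, E) 𝓘(ℝ, E) (extChartAt 𝓘(ℝ, E) p).symm X
      (range 𝓘(ℝ, E)) x = coordField p X x := by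
  rw [VectorField.mpullbackWithin_apply, coordField,
    coordMap_eq_mfderiv ((extChartAt 𝓘(ℝ, E) p).map_target hx)]
  have h1 := mfderiv_extChartAt_comp_mfderivWithin_extChartAt_symm (I := 𝓘(ℝ, E)) hx
  obtain ⟨e, he⟩ := isInvertible_mfderivWithin_extChartAt_symm (I := 𝓘(ℝ, E)) hx
  rw [← he] at h1 ⊢
  rw [ContinuousLinearMap.inverse_equiv]
  set z := X ((extChartAt 𝓘(ℝ, E) p).symm x)
  have h2 := congrArg (fun T => T (e.symm z)) h1
  simp only [ContinuousLinearMap.comp_apply, ContinuousLinearEquiv.coe_coe,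
    ContinuousLinearEquiv.apply_symm_apply] at h2
  exact h2.symm

lemma coordMap_self (p : M) (z : TangentSpace 𝓘(ℝ, E) p) : coordMap p p z = (z : E) :=
  tangentCoordChange_self (mem_extChartAt_source p)

/-- The bracket is computed by pulling the fields back to the chart at `p`, whose derivative at `p`
is the identity in the preferred trivialization. -/
lemma coordMap_mlieBracket (p : M) (X Y : (q : M) → TangentSpace 𝓘(ℝ, E) q) :
    coordMap p p (VectorField.mlieBracket 𝓘(ℝ, E) X Y p) =
      fderiv ℝ (coordField p Y) (extChartAt 𝓘(ℝ, E) p p)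
        (coordField p X (extChartAt 𝓘(ℝ, E) p p)) -
      fderiv ℝ (coordField p X) (extChartAt 𝓘(ℝ, E) p p)
        (coordField p Y (extChartAt 𝓘(ℝ, E) p p)) := by
  have hev : ∀ X : (q : M) → TangentSpace 𝓘(ℝ, E) q,
      VectorField.mpullbackWithin 𝓘(ℝ, E) 𝓘(ℝ, E) (extChartAt 𝓘(ℝ, E) p).symm X
        (range 𝓘(ℝ, E)) =ᶠ[𝓝 (extChartAt 𝓘(ℝ, E) p p)] coordField p X := fun X =>
    Filter.Eventually.mono (extChartAt_target_mem_nhds p) fun x hx =>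
      mpullbackWithin_extChartAt_symm p X hx
  have hid : ∀ z : E, (mfderiv 𝓘(ℝ, E) 𝓘(ℝ, E) (extChartAt 𝓘(ℝ, E) p) p).inverse z = z :=
    fun z => (congrArg (fun T : E →L[ℝ] E => T.inverse z)
      (mfderiv_extChartAt_self (I := 𝓘(ℝ, E)) (x := p))).trans
        (congrArg (fun T : E →L[ℝ] E => T z) ContinuousLinearMap.inverse_id)
  rw [coordMap_self, ← VectorField.mlieBracketWithin_univ, VectorField.mlieBracketWithin_apply,
    preimage_univ, univ_inter]
  refine (hid _).trans ?_
  have hbr : ∀ (V W V' W' : E → E) (x : E), V =ᶠ[𝓝 x] V' → W =ᶠ[𝓝 x] W' →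
      VectorField.lieBracketWithin ℝ V W (range 𝓘(ℝ, E)) x =
        fderiv ℝ W' x (V' x) - fderiv ℝ V' x (W' x) := by
    intro V W V' W' x hV hW
    rw [modelWithCornersSelf_coe, range_id, VectorField.lieBracketWithin_univ,
      VectorField.lieBracket, hV.fderiv_eq, hW.fderiv_eq, hV.self_of_nhds, hW.self_of_nhds]
  exact hbr _ _ _ _ _ (hev X) (hev Y)

/-- The curvature tensor in coordinates. -/
def curvatureBilinear (H : Distribution E M) (p : M) (A : E → E →L[ℝ] (Fin m → ℝ))
    (S : E → (Fin m → ℝ) →L[ℝ] E) :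
    H p →ₗ[ℝ] H p →ₗ[ℝ] (TangentSpace 𝓘(ℝ, E) p ⧸ H p) :=
  LinearMap.mk₂ ℝ (fun u v => (H p).mkQ (coordInv p p (S (extChartAt 𝓘(ℝ, E) p p)
    (fderiv ℝ A (extChartAt 𝓘(ℝ, E) p p) (coordMap p p v) (coordMap p p u) -
      fderiv ℝ A (extChartAt 𝓘(ℝ, E) p p) (coordMap p p u) (coordMap p p v)))))
    (fun u u' v => by
      rw [← map_add, ← map_add, ← map_add]
      congr 3
      simp only [Submodule.coe_add, map_add, add_apply]
      abel)
    (fun c u v => by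
      rw [← map_smul, ← map_smul, ← map_smul]
      congr 3
      simp only [Submodule.coe_smul, map_smul, smul_apply, smul_sub])
    (fun u v v' => by
      rw [← map_add, ← map_add, ← map_add]
      congr 3
      simp only [Submodule.coe_add, map_add, add_apply]
      abel)
    (fun c u v => by
      rw [← map_smul, ← map_smul, ← map_smul]
      congr 3
      simp only [Submodule.coe_smul, map_smul, smul_apply, smul_sub])

/-- The difference of the representatives is `z - S A z` in coordinates, which `A` kills. Thus a
class modulo `H` is determined by `A z`. -/
lemma IsAdapted.mkQ_eq (h : IsAdapted H K p Ω A S) (z : TangentSpace 𝓘(ℝ, E) p) :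
    (H p).mkQ z = (H p).mkQ (coordInv p p
      (S (extChartAt 𝓘(ℝ, E) p p) (A (extChartAt 𝓘(ℝ, E) p p) (coordMap p p z)))) := by
  rw [Submodule.mkQ_apply, Submodule.mkQ_apply, Submodule.Quotient.eq,
    h.mem_H p (mem_extChartAt_source p) h.mem, map_sub, map_sub,
    coordMap_coordInv (mem_extChartAt_source p), h.A_S _ h.mem, sub_self]

/-- Differentiating `A X = 0` gives `A (dX w) = -dA(w) X`. Applied to both terms of the bracket,
this removes every derivative of the fields, so `A [X, Y]` depends only on their values at `p`. -/
theorem IsAdapted.isCurvatureAt (h : IsAdapted H K p Ω A S) :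
    IsCurvatureAt H p (alternatingOfBilinear (curvatureBilinear H p A S)
      (fun v => by simp [curvatureBilinear])) := by
  have hvanish : ∀ X : (q : M) → TangentSpace 𝓘(ℝ, E) q, IsSectionNear H X p →
      ∀ w, A (extChartAt 𝓘(ℝ, E) p p) (fderiv ℝ (coordField p X) (extChartAt 𝓘(ℝ, E) p p) w) =
        -fderiv ℝ A (extChartAt 𝓘(ℝ, E) p p) w (coordField p X (extChartAt 𝓘(ℝ, E) p p)) := by
    intro X hX w
    have h1 : HasFDerivAt (coordField p X) _ (extChartAt 𝓘(ℝ, E) p p) :=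
      (hX.1.eventually_contDiffAt.self_of_nhds.differentiableAt (by simp)).hasFDerivAt
    have h2 := (h.hasFDerivAt_A h.mem).clm_apply h1
    have h3 : (fun x => A x (coordField p X x)) =ᶠ[𝓝 (extChartAt 𝓘(ℝ, E) p p)] fun _ => 0 := by
      have hc := continuousAt_extChartAt_symm (I := 𝓘(ℝ, E)) p
      rw [ContinuousAt, extChartAt_to_inv] at hc
      filter_upwards [h.isOpen.mem_nhds h.mem, hc.eventually hX.2] with x hx hxH
      have hxt := h.subset_target hx
      have h4 := (h.mem_H _ ((extChartAt 𝓘(ℝ, E) p).map_target hxt)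
        (by rwa [(extChartAt 𝓘(ℝ, E) p).right_inv hxt]) _).1 hxH
      rw [(extChartAt 𝓘(ℝ, E) p).right_inv hxt] at h4
      exact h4
    have h4 := h2.unique ((hasFDerivAt_const 0 _).congr_of_eventuallyEq h3)
    have h5 := congrArg (fun T : E →L[ℝ] (Fin m → ℝ) => T w) h4
    exact eq_neg_of_add_eq_zero_left h5
  intro X Y u v hX hY hu hv
  rw [alternatingOfBilinear_apply, h.mkQ_eq (VectorField.mlieBracket 𝓘(ℝ, E) X Y p),
    coordMap_mlieBracket, map_sub, hvanish X hX, hvanish Y hY, curvatureBilinear,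
    LinearMap.mk₂_apply, coordField_extChartAt (mem_extChartAt_source p),
    coordField_extChartAt (mem_extChartAt_source p), hu, hv]
  congr 3
  abel

/-- Any two vectors of `H p` extend to sections of `H`, so the bracket condition determines the
alternating map, and the chosen one agrees with the explicit one. -/
theorem IsAdapted.curvature_eq (h : IsAdapted H K p Ω A S) (hH : IsSmoothSubbundle H)
    (u v : H p) : curvature H p ![u, v] =
      (H p).mkQ (coordInv p p (S (extChartAt 𝓘(ℝ, E) p p)
        (fderiv ℝ A (extChartAt 𝓘(ℝ, E) p p) (coordMap p p v) (coordMap p p u) -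
          fderiv ℝ A (extChartAt 𝓘(ℝ, E) p p) (coordMap p p u) (coordMap p p v)))) := by
  have hex : ∃ C, IsCurvatureAt H p C := ⟨_, h.isCurvatureAt⟩
  obtain ⟨X, hX, hXu⟩ := hH.exists_isSectionNear p u
  obtain ⟨Y, hY, hYv⟩ := hH.exists_isSectionNear p v
  rw [curvature, dif_pos hex, hex.choose_spec X Y u v hX hY hXu hYv,
    ← h.isCurvatureAt X Y u v hX hY hXu hYv]
  rfl

end CurvatureFormula

/-- Derivative of the image of a curve under a continuous linear map with values in a topological
vector space. -/
lemma hasDerivWithinAt_of_eventuallyEq_clm {F : Type*} [NormedAddCommGroup F] [NormedSpace ℝ F]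
    {G : Type*} [AddCommGroup G] [Module ℝ G] [TopologicalSpace G] [ContinuousSMul ℝ G]
    (T : F →L[ℝ] G) {f : ℝ → F} {f' : F} {g : ℝ → G} {s : Set ℝ} {x : ℝ}
    (hf : HasDerivWithinAt f f' s x) (hx : x ∈ s) (hg : ∀ᶠ r in 𝓝[s] x, g r = T (f r)) :
    HasDerivWithinAt g (T f') s x := by
  have h1 := HasFDerivWithinAt.isLittleOTVS (hasDerivWithinAt_iff_hasFDerivWithinAt.1 hf)
  refine hasDerivWithinAt_iff_hasFDerivWithinAt.2 (HasFDerivWithinAt.of_isLittleOTVS ?_)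
  refine (T.isBigOTVS_comp.trans_isLittleOTVS h1).congr' ?_ (EventuallyEq.refl _ _)
  have hgx := hg.self_of_nhdsWithin hx
  filter_upwards [hg] with r hr
  simp [hr, hgx]

/-! ### Transport of classes modulo `H`, and its derivative. -/

section QuotientTransport

variable {E : Type*} [NormedAddCommGroup E] [NormedSpace ℝ E]
  {M : Type*} [TopologicalSpace M] [ChartedSpace E M] [IsManifold 𝓘(ℝ, E) ∞ M]
  {H K : Distribution E M} {β : ℝ → M} {J : Set ℝ}

omit [IsManifold 𝓘(ℝ, E) ∞ M] in
lemma quotientIso_mkQ (hHK : ∀ p, IsCompl (H p) (K p)) (p : M) (k : K p) :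
    quotientIso H K hHK p ((H p).mkQ k) = k :=
  Submodule.quotientEquivOfIsCompl_apply_mk_right (hHK p) k

omit [IsManifold 𝓘(ℝ, E) ∞ M] in
lemma mkQ_quotientIso (hHK : ∀ p, IsCompl (H p) (K p)) (p : M)
    (z : TangentSpace 𝓘(ℝ, E) p ⧸ H p) :
    (H p).mkQ (quotientIso H K hHK p z) = z := by
  apply (quotientIso H K hHK p).injective
  rw [quotientIso_mkQ]

theorem quotientTransport_mkQ [FiniteDimensional ℝ E] (hH : IsSmoothSubbundle H)
    (hK : IsSmoothSubbundle K) (hHK : ∀ p, IsCompl (H p) (K p))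
    (hJ : J.OrdConnected) (hJ' : J.Nontrivial) (hβ : ContMDiffOn 𝓘(ℝ, ℝ) 𝓘(ℝ, E) ∞ β J)
    (hβH : ∀ t ∈ J, velocity (E := E) β J t ∈ H (β t)) {s t : ℝ} (hs : s ∈ J) (ht : t ∈ J)
    {σ : (t : ℝ) → TangentSpace 𝓘(ℝ, E) (β t)} (hσ : ∀ t ∈ J, IsParallelAt H K β J σ t) :
    quotientTransport H K hHK β J s t ((H (β s)).mkQ (σ s)) = (H (β t)).mkQ (σ t) := by
  have h1 := quotientIso_mkQ hHK (β s) ⟨σ s, (hσ s hs).1⟩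
  have h2 := quotientIso_mkQ hHK (β t) ⟨σ t, (hσ t ht).1⟩
  simp only at h1 h2
  rw [quotientTransport, LinearMap.comp_apply, LinearMap.comp_apply, LinearEquiv.coe_coe,
    LinearEquiv.coe_coe, h1, transport_eq hH hK hHK hJ hJ' hβ hβH hs ht hσ, ← h2,
    LinearEquiv.symm_apply_apply]

end QuotientTransport

/-- Comparison of the parallel transports defined by two complements of `H`, with all data
expressed in the chart at `β t`. -/
theorem hasDerivWithinAt_quotientTransport
    {E : Type*} [NormedAddCommGroup E] [NormedSpace ℝ E] [FiniteDimensional ℝ E]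
    {M : Type*} [TopologicalSpace M] [ChartedSpace E M] [IsManifold 𝓘(ℝ, E) ∞ M]
    {H K₁ K₂ : Distribution E M} (hH : IsSmoothSubbundle H)
    (hK₁ : IsSmoothSubbundle K₁) (hc₁ : ∀ p, IsCompl (H p) (K₁ p))
    {J : Set ℝ} (hJ : J.OrdConnected) (hJ' : J.Nontrivial)
    {β : ℝ → M} (hβ : ContMDiffOn 𝓘(ℝ, ℝ) 𝓘(ℝ, E) ∞ β J)
    (hβH : ∀ t ∈ J, velocity (E := E) β J t ∈ H (β t)) {t₀ t : ℝ} (ht₀ : t₀ ∈ J) (ht : t ∈ J)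
    {σ : (t : ℝ) → TangentSpace 𝓘(ℝ, E) (β t)} (hσ : ∀ t ∈ J, IsParallelAt H K₂ β J σ t)
    {g : ∀ r, TangentSpace 𝓘(ℝ, E) (β r) ⧸ H (β r)} (hg : ∀ r ∈ J, g r = (H (β r)).mkQ (σ r))
    {Ω Ω' : Set E} {m : ℕ} {A : E → E →L[ℝ] (Fin m → ℝ)} {S S' : E → (Fin m → ℝ) →L[ℝ] E}
    (h₁ : IsAdapted H K₁ (β t) Ω A S) (h₂ : IsAdapted H K₂ (β t) Ω' A S') :
    HasDerivWithinAt
      (fun r => quotientTransport H K₁ hc₁ β J r t₀ (g r))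
      (quotientTransport H K₁ hc₁ β J t t₀ ((H (β t)).mkQ (coordInv (β t) (β t)
        (S (extChartAt 𝓘(ℝ, E) (β t) (β t))
          ((connectionMap A S' (extChartAt 𝓘(ℝ, E) (β t) (β t))
              (derivWithin (fun r => extChartAt 𝓘(ℝ, E) (β t) (β r)) J t) -
            connectionMap A S (extChartAt 𝓘(ℝ, E) (β t) (β t))
              (derivWithin (fun r => extChartAt 𝓘(ℝ, E) (β t) (β r)) J t))
            (A (extChartAt 𝓘(ℝ, E) (β t) (β t)) (coordMap (β t) (β t) (σ t))))))))
      J t := by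
  have hJu := uniqueDiffOn_of_ordConnected hJ hJ'
  have hflat := isFlat_isParallelAt hH hK₁ hc₁ hJ hJ' hβ hβH
  obtain ⟨ε, hε, Φ, Ψ, hΨ1, hΨ⟩ := h₁.exists_fundamental_solution hJ hJ' hβ ht
  have htε : t ∈ J ∩ Ioo (t - ε) (t + ε) := ⟨ht, by constructor <;> linarith⟩
  set w : ℝ → (Fin m → ℝ) := fun r =>
    A (extChartAt 𝓘(ℝ, E) (β t) (β r)) (coordMap (β t) (β r) (σ r)) with hw
  -- `T` does not depend on `r`: near `t` the transported class is `T (Ψ r (w r))`, which reduces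
  -- the claim to differentiating a curve in `ℝ^m`. Since `Ψ t = 1`, its derivative there is the
  -- difference of the two connection maps applied to `w t`.
  let T : (Fin m → ℝ) →ₗ[ℝ] (TangentSpace 𝓘(ℝ, E) (β t₀) ⧸ H (β t₀)) :=
    quotientTransport H K₁ hc₁ β J t t₀ ∘ₗ (H (β t)).mkQ ∘ₗ
      ((coordInv (β t) (β t)).comp (S (extChartAt 𝓘(ℝ, E) (β t) (β t)))).toLinearMap
  let T' : (Fin m → ℝ) →L[ℝ] (TangentSpace 𝓘(ℝ, E) (β t₀) ⧸ H (β t₀)) :=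
    ⟨T, T.continuous_of_finiteDimensional⟩
  have hwd : HasDerivWithinAt w (connectionMap A S' (extChartAt 𝓘(ℝ, E) (β t) (β t))
      (derivWithin (fun r => extChartAt 𝓘(ℝ, E) (β t) (β r)) J t) (w t)) J t :=
    (h₂.isParallelAt_iff ht (hJu t ht) ((hβ t ht).mdifferentiableWithinAt (by simp)) (hβH t ht)
      (mem_extChartAt_source _) h₂.mem
      (eventually_mem_nhdsWithin.mono fun r hr => (hσ r hr).1)).1 (hσ t ht)
  have hΨw := (hΨ t htε).2.2.1.clm_apply hwd
  have hder := hasDerivWithinAt_of_eventuallyEq_clm T' (g := fun r =>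
    quotientTransport H K₁ hc₁ β J r t₀ (g r)) hΨw ht ?_
  · convert! hder using 1
    change _ = T _
    simp only [T, LinearMap.comp_apply, ContinuousLinearMap.coe_coe,
      ContinuousLinearMap.comp_apply, hΨ1, one_mul, one_apply_eq_self, neg_apply,
      sub_apply, hw]
    rw [neg_add_eq_sub]
  -- Let `τ` be the `K₁`-parallel section whose class at `r` is that of `σ r`. As `A` sees only
  -- classes modulo `H`, its value on `τ r` is `w r`; constancy of `Ψ A τ` between `r` and `t` then
  -- gives `A (τ t) = Ψ r (w r)`.
  · filter_upwards [inter_mem_nhdsWithin J (isOpen_Ioo.mem_nhds htε.2)] with r hr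
    have hk := mkQ_quotientIso hc₁ (β r) ((H (β r)).mkQ (σ r))
    obtain ⟨τ, hτr, hτ⟩ := hflat.exists_solution hJ hr.1
      (quotientIso H K₁ hc₁ (β r) ((H (β r)).mkQ (σ r))).2
    rw [← hτr] at hk
    have hA : A (extChartAt 𝓘(ℝ, E) (β t) (β r)) (coordMap (β t) (β r) (τ r)) = w r := by
      rw [Submodule.mkQ_apply, Submodule.mkQ_apply, Submodule.Quotient.eq,
        h₁.mem_H _ (hΨ r hr).1.1 (hΨ r hr).1.2, map_sub, map_sub, sub_eq_zero] at hk
      exact hk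
    have hconst := h₁.fundamental_solution_const hJ hJ' hβ hβH isOpen_Ioo ordConnected_Ioo
      (fun s hs => ⟨(hΨ s hs).1, (hΨ s hs).2.2.1⟩) (fun s hs => hτ s hs.1) htε hr
    rw [hΨ1, hA, one_apply_eq_self] at hconst
    rw [hg r hr.1, ← hk, quotientTransport_mkQ hH hK₁ hc₁ hJ hJ' hβ hβH hr.1 ht₀ hτ,
      ← quotientTransport_mkQ hH hK₁ hc₁ hJ hJ' hβ hβH ht ht₀ hτ, h₁.mkQ_eq (τ t), hconst]
    rfl

end TangentSubbundle

end

open TangentSubbundle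

theorem theorem10
    {E : Type*} [NormedAddCommGroup E] [NormedSpace ℝ E] [FiniteDimensional ℝ E]
    {M : Type*} [TopologicalSpace M] [T2Space M] [ChartedSpace E M] [IsManifold 𝓘(ℝ, E) ∞ M]
    (H K₁ K₂ : TangentSubbundle.Distribution E M)
    (hH : TangentSubbundle.IsSmoothSubbundle H)
    (hK₁ : TangentSubbundle.IsSmoothSubbundle K₁)
    (hK₂ : TangentSubbundle.IsSmoothSubbundle K₂)
    (hc₁ : ∀ p, IsCompl (H p) (K₁ p)) (hc₂ : ∀ p, IsCompl (H p) (K₂ p))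
    (J : Set ℝ) (hJ : J.OrdConnected) (hJ' : J.Nontrivial)
    (β : ℝ → M) (hβ : ContMDiffOn 𝓘(ℝ, ℝ) 𝓘(ℝ, E) ∞ β J)
    (hβH : ∀ t ∈ J, TangentSubbundle.velocity (E := E) β J t ∈ H (β t))
    (t₀ : ℝ) (ht₀ : t₀ ∈ J) (v : TangentSpace 𝓘(ℝ, E) (β t₀) ⧸ H (β t₀))
    (t : ℝ) (ht : t ∈ J) :
    HasDerivWithinAt
      (fun r : ℝ => TangentSubbundle.quotientTransport H K₁ hc₁ β J r t₀
        (TangentSubbundle.quotientTransport H K₂ hc₂ β J t₀ r v))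
      (TangentSubbundle.quotientTransport H K₁ hc₁ β J t t₀
        (TangentSubbundle.curvature H (β t)
          ![TangentSubbundle.projAlong H K₁ hc₁ (β t)
              (TangentSubbundle.quotientIso H K₂ hc₂ (β t)
                (TangentSubbundle.quotientTransport H K₂ hc₂ β J t₀ t v)),
            ⟨TangentSubbundle.velocity β J t, hβH t ht⟩]))
      J t := by
  have hJu := uniqueDiffOn_of_ordConnected hJ hJ'
  obtain ⟨σ, hσ₀, hσ⟩ := (isFlat_isParallelAt hH hK₂ hc₂ hJ hJ' hβ hβH).exists_solution hJ ht₀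
    (quotientIso H K₂ hc₂ (β t₀) v).2
  have hv : ∀ r ∈ J, quotientTransport H K₂ hc₂ β J t₀ r v = (H (β r)).mkQ (σ r) := by
    intro r hr
    rw [← quotientTransport_mkQ hH hK₂ hc₂ hJ hJ' hβ hβH ht₀ hr hσ, hσ₀, mkQ_quotientIso]
  obtain ⟨Ω, m, A, S, h₁⟩ := exists_isAdapted hH hK₁ hc₁ (β t)
  obtain ⟨Ω', m', A', S', h'⟩ := exists_isAdapted hH hK₂ hc₂ (β t)
  -- Using one `A` for both complements makes the two equations live in the same coordinates on `TM
  -- / H`.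
  have h₂ := h₁.change h'
  have hsrc := mem_extChartAt_source (I := 𝓘(ℝ, E)) (β t)
  have hder := hasDerivWithinAt_quotientTransport hH hK₁ hc₁ hJ hJ' hβ hβH ht₀ ht hσ hv h₁ h₂
  have hσt := (h₂.mem_K _ hsrc h₂.mem (σ t)).1 (hσ t ht).1
  have hiso := quotientIso_mkQ hc₂ (β t) ⟨σ t, (hσ t ht).1⟩
  simp only at hiso
  have hproj : coordMap (E := E) (β t) (β t)
      (projAlong H K₁ hc₁ (β t) (σ t) : TangentSpace 𝓘(ℝ, E) (β t)) =
      coordMap (E := E) (β t) (β t) (σ t) - S (extChartAt 𝓘(ℝ, E) (β t) (β t))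
        (A (extChartAt 𝓘(ℝ, E) (β t) (β t)) (coordMap (E := E) (β t) (β t) (σ t))) := by
    have hz : σ t - projAlong H K₁ hc₁ (β t) (σ t) ∈ K₁ (β t) :=
      Submodule.sub_projection_mem (hc₁ (β t)) (σ t)
    have h3 := (h₁.mem_K _ hsrc h₁.mem _).1 hz
    have h4 := (h₁.mem_H _ hsrc h₁.mem _).1 (projAlong H K₁ hc₁ (β t) (σ t)).2
    rw [map_sub, map_sub, h4, sub_zero] at h3
    rw [h3, sub_sub_cancel]
  have hvel := coordMap_mfderivWithin (p := β t) (hJu t ht)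
    ((hβ t ht).mdifferentiableWithinAt (by simp)) hsrc
  rw [hv t ht, hiso, h₁.curvature_eq hH, hproj, hvel]
  -- Because `σ t = S' A σ t` in coordinates, the difference of the connection maps is `dA(b') h -
  -- dA(h) b'` with `h = σ t - S A σ t`, the projection found in `hproj`.
  convert! hder using 5
  rw [sub_apply, connectionMap_apply, connectionMap_apply, hσt]
  simp only [map_sub, sub_apply]
  abel
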